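/- Let $n\ge 1$, let $\mathbb{C}^n$ carry the norm $\|z\|=\max_{1\le k\le n}|z_k|$, and let $D^n=\{z\in\mathbb{C}^n:\|z\|<1\}$ be the unit polydisk. Let $0\le\alpha\le\frac{37-\sqrt{505}}{36}$. A normalized almost starlike mapping of order $\alpha$ on $D^n$ is a holomorphic mapping $f:D^n\to\mathbb{C}^n$ with $f(0)=0$ and $Df(0)=I$, whose derivative $Df(z)$ is invertible for every $z\in D^n$, and such that $$\operatorname{Re} T\big[(Df(z))^{-1}f(z)\big]\ge\alpha\|z\|$$ for every $z\in D^n\setminus\{0\}$ and every linear functional $T$ on $\mathbb{C}^n$ with $\|T\|=1$ and $T(z)=\|z\|$. **Theorem 3.5.** Let $f=(f_1,\dots,f_n)$ be a normalized almost starlike mapping of order $\alpha$ on $D^n$, and suppose that $$\frac{D^2f_k(0)(z^2)}{2!}=a_kz_k^2,\qquad \frac{D^3f_k(0)(z^3)}{3!}=b_kz_k^3,\qquad z\in D^n,\ k=1,\dots,n,$$ where $a_k=\frac1{2!}\frac{\partial^2f_k(0)}{\partial z_k^2}$ and $b_k=\frac1{3!}\frac{\partial^3f_k(0)}{\partial z_k^3}$.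 Then $$\frac{\|D^4f(0)(z^4)\|}{4!}\le\frac{(1-\alpha)(3-4\alpha)(4-6\alpha)}{3}\,\|z\|^4,\qquad z\in D^n.$$ The estimate is sharp: for every $n\ge 1$ and every such $\alpha$ there are a mapping $f$ satisfying all of these hypotheses and a point $z\in D^n\setminus\{0\}$ for which equality holds. -/

import Mathlib

open Metric

section AlmostStarlike

variable {X : Type*} [NormedAddCommGroup X] [NormedSpace ℂ X]

/-- `T(x)`: the continuous linear functionals `T` with `‖T‖ = 1` and `T x = ‖x‖`
(meant for `x ≠ 0`). -/
def supportFunctionals (x : X) : Set (X →L[ℂ] ℂ) :=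
  {T | ‖T‖ = 1 ∧ T x = (‖x‖ : ℂ)}

/-- `f` is holomorphic on the open unit ball, and its Fréchet derivative has a bounded inverse
at every point of the ball. -/
def IsLocallyBiholomorphicOnBall (f : X → X) : Prop :=
  DifferentiableOn ℂ f (ball 0 1) ∧ ∀ x ∈ ball (0 : X) 1, (fderiv ℂ f x).IsInvertible

/-- `f(0) = 0` and `Df(0) = I`. -/
def IsNormalizedAtZero (f : X → X) : Prop :=
  f 0 = 0 ∧ fderiv ℂ f 0 = ContinuousLinearMap.id ℂ X

/-- Almost starlike mappings of order `α` on the open unit ball `B`: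
`f` is locally biholomorphic on `B` and `Re T_x[(Df(x))⁻¹ f(x)] ≥ α ‖x‖`
for all `x ∈ B \ {0}` and all `T_x ∈ T(x)`. -/
def IsAlmostStarlike (α : ℝ) (f : X → X) : Prop :=
  IsLocallyBiholomorphicOnBall f ∧
    ∀ x ∈ ball (0 : X) 1, x ≠ 0 → ∀ T ∈ supportFunctionals x,
      α * ‖x‖ ≤ (T ((fderiv ℂ f x).inverse (f x))).re

/-- The `m`-th homogeneous part `D^m f(0)(z^m) / m!` of the expansion of `f` at `0`. -/
noncomputable def homogeneousPart (f : X → X) (m : ℕ) (z : X) : X :=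
  ((m.factorial : ℂ)⁻¹) • iteratedFDeriv ℂ m f 0 (fun _ => z)

end AlmostStarlike

/-- The `m`-th homogeneous part of `f` on the unit polydisk of `ℂⁿ` (the open unit ball for the
maximum norm, which is the norm of `Fin n → ℂ`) is diagonal with coefficients `c`:
`D^m f_k(0)(z^m) / m! = c_k z_k^m` for `z` in the polydisk and every `k`.
Taking for `z` a multiple of the `k`-th unit vector shows that
`c_k` is `(1 / m!) ∂^m f_k(0) / ∂z_k^m`. -/
def HasDiagonalPart {n : ℕ} (f : (Fin n → ℂ) → (Fin n → ℂ)) (m : ℕ) (c : Fin n → ℂ) : Prop :=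
  ∀ z ∈ ball (0 : Fin n → ℂ) 1, ∀ k : Fin n, homogeneousPart f m z k = c k * z k ^ m

/-! The proof reduces to a coefficient problem in one variable. Let g = (Df)⁻¹f, so that Df(x) g(x)
= f(x), and for ‖z‖ = 1 write g(ζz) = ζΓ(ζ). The diagonal hypotheses make the cubic Taylor
polynomial of f_k a function of x_k alone, so up to order four the other coordinates enter only
through the quartic part, which Euler's relation evaluates. If |z_k| = 1, then p = Γ_k / z_k has
p(0) = 1, and the functional supported on coordinate k gives Re p ≥ α. With A = a_k z_k, B = b_k
z_k² and P the quartic component divided by z_k, `isBigO_field_line` yields p(1 + 2Aζ + 3Bζ²) = 1 +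
Aζ + Bζ² - 3Pζ³ + O(ζ⁴), where -3 = 1 - 4.

Put γ = 1 - 2α, β = 1 - α. Then p = (1 + γζφ)/(1 - ζφ) with |φ| ≤ 1, and P is -2β/3 times a
functional of the first three coefficients of φ. In Schur parameters, `norm_schur_functional_le`
bounds that functional by ν = (3β - 1)(4β - 1), and 2βν/3 is the constant of the theorem. The
maximum principle in the k-th coordinate removes the restriction |z_k| = ‖z‖.

Equality holds for the map acting in each coordinate by ζ(1 + γζ)^(-(1+γ)/γ), for which p = (1 +
γζ)/(1 - ζ) when z_k = 1. -/

open Filter Topology Asymptotics ComplexConjugate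

universe u

/-! ### Smoothness of holomorphic maps of several variables. -/

/-- The derivative of a holomorphic map is bounded near every point. -/
theorem eventually_norm_fderiv_le {E F : Type*} [NormedAddCommGroup E] [NormedSpace ℂ E]
    [NormedAddCommGroup F] [NormedSpace ℂ F] {f : E → F} {U : Set E} (hU : IsOpen U)
    (hf : DifferentiableOn ℂ f U) {x₀ : E} (hx₀ : x₀ ∈ U) :
    ∃ R > 0, ∃ C, ball x₀ R ⊆ U ∧ ∀ x ∈ ball x₀ R, ‖fderiv ℂ f x‖ ≤ C := by
  have hc : ContinuousAt f x₀ := (hf.differentiableAt (hU.mem_nhds hx₀)).continuousAt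
  have h1 : ∀ᶠ x in 𝓝 x₀, x ∈ U ∧ dist (f x) (f x₀) < 1 :=
    Filter.Eventually.and (hU.mem_nhds hx₀) (hc (ball_mem_nhds _ one_pos))
  obtain ⟨R, hR, hball⟩ := Metric.eventually_nhds_iff_ball.1 h1
  refine ⟨R / 2, by positivity, 2 / (R / 2), fun x hx => (hball x ?_).1, fun x hx => ?_⟩
  · exact ball_subset_ball (by linarith) hx
  have hsub : ball x (R / 2) ⊆ ball x₀ R :=
    ball_subset_ball' (by rw [mem_ball] at hx; linarith)
  refine Complex.norm_fderiv_le_div_of_mapsTo_ball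
    (hf.mono fun y hy => (hball y (hsub hy)).1) (fun y hy => ?_) (by positivity)
  have h2 := (hball y (hsub hy)).2
  have h3 := (hball x (hsub (mem_ball_self (by positivity)))).2
  rw [mem_closedBall]
  linarith [dist_triangle_right (f y) (f x) (f x₀)]

/-- The directional derivatives of a holomorphic map of several variables are holomorphic. -/
theorem differentiableOn_fderiv_apply {E F : Type*} [NormedAddCommGroup E]
    [NormedSpace ℂ E] [FiniteDimensional ℂ E] [NormedAddCommGroup F] [NormedSpace ℂ F]
    [CompleteSpace F] [SecondCountableTopology F] {f : E → F} {U : Set E} (hU : IsOpen U)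
    (hf : DifferentiableOn ℂ f U) (v : E) :
    DifferentiableOn ℂ (fun x => fderiv ℂ f x v) U := by
  intro x₀ hx₀
  apply DifferentiableAt.differentiableWithinAt
  obtain ⟨R, hR, C, hRU, hC⟩ := eventually_norm_fderiv_le hU hf hx₀
  obtain ⟨ρ, hρ, hρv⟩ : ∃ ρ : ℝ, 0 < ρ ∧ ρ * ‖v‖ < R / 2 := by
    refine ⟨R / 2 / (‖v‖ + 1), by positivity, ?_⟩
    rw [div_mul_eq_mul_div, div_lt_iff₀ (by positivity)]
    nlinarith [norm_nonneg v]
  have hmem : ∀ x ∈ ball x₀ (R / 2), ∀ ζ ∈ closedBall (0 : ℂ) ρ, x + ζ • v ∈ ball x₀ R := by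
    intro x hx ζ hζ
    rw [mem_closedBall_zero_iff] at hζ
    rw [mem_ball, dist_eq_norm] at hx ⊢
    calc ‖x + ζ • v - x₀‖ = ‖(x - x₀) + ζ • v‖ := by congr 1; abel
      _ ≤ ‖x - x₀‖ + ‖ζ‖ * ‖v‖ := by rw [← norm_smul]; exact norm_add_le _ _
      _ < R := by nlinarith [norm_nonneg v]
  have hfd : ∀ y ∈ ball x₀ R, HasFDerivAt f (fderiv ℂ f y) y := fun y hy =>
    (hf.differentiableAt (hU.mem_nhds (hRU hy))).hasFDerivAt
  have hcirc : ∀ θ : ℝ, circleMap 0 ρ θ ∈ closedBall (0 : ℂ) ρ := fun θ =>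
    circleMap_mem_closedBall 0 hρ.le θ
  -- Cauchy's formula on the line x + ζv writes Df(x)v as a circle integral whose kernel `k` does
  -- not depend on x. Differentiating under the integral needs only a local bound and measurability
  -- of Df, not its continuity.
  let k : ℝ → ℂ := fun θ => deriv (circleMap 0 ρ) θ * ((circleMap 0 ρ θ - 0) ^ 2)⁻¹
  have hk : Continuous k := by
    have h1 : Continuous (circleMap 0 ρ) := continuous_circleMap 0 ρ
    have h0 : ∀ θ, (circleMap 0 ρ θ - 0) ^ 2 ≠ 0 := fun θ => by
      simp [hρ.ne']
    have h2 : Continuous (deriv (circleMap 0 ρ)) := by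
      rw [funext (deriv_circleMap 0 ρ)]
      exact h1.mul continuous_const
    exact h2.mul (((h1.sub continuous_const).pow 2).inv₀ h0)
  have hcont : ∀ x ∈ ball x₀ (R / 2), Continuous fun θ : ℝ => f (x + circleMap 0 ρ θ • v) := by
    intro x hx
    refine continuous_iff_continuousAt.2 fun θ => ?_
    refine ContinuousAt.comp (f := fun θ : ℝ => x + circleMap 0 ρ θ • v)
      (hfd _ (hmem x hx _ (hcirc θ))).continuousAt ?_
    exact (continuous_const.add ((continuous_circleMap 0 ρ).smul continuous_const)).continuousAt
  have hball : ball x₀ (R / 2) ∈ 𝓝 x₀ := ball_mem_nhds _ (by positivity)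
  have key : HasFDerivAt
      (fun x => ∫ θ in (0 : ℝ)..2 * Real.pi, k θ • f (x + circleMap 0 ρ θ • v))
      (∫ θ in (0 : ℝ)..2 * Real.pi, k θ • fderiv ℂ f (x₀ + circleMap 0 ρ θ • v)) x₀ := by
    refine intervalIntegral.hasFDerivAt_integral_of_dominated_of_fderiv_le
      (F' := fun x θ => k θ • fderiv ℂ f (x + circleMap 0 ρ θ • v))
      (bound := fun θ => ‖k θ‖ * C) hball ?_ ?_ ?_ ?_ ?_ ?_
    · filter_upwards [hball] with x hx
      exact (hk.smul (hcont x hx)).aestronglyMeasurable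
    · exact (hk.smul (hcont x₀ (mem_of_mem_nhds hball))).intervalIntegrable _ _
    · let _ : MeasurableSpace E := borel E
      have : BorelSpace E := ⟨rfl⟩
      have : ProperSpace E := FiniteDimensional.proper ℂ E
      have hm : Measurable fun θ : ℝ => fderiv ℂ f (x₀ + circleMap 0 ρ θ • v) :=
        (measurable_fderiv ℂ f).comp (continuous_const.add
          ((continuous_circleMap 0 ρ).smul continuous_const)).measurable
      exact hk.aestronglyMeasurable.smul hm.aestronglyMeasurable
    · refine Eventually.of_forall fun θ _ x hx => ?_
      rw [norm_smul]
      exact mul_le_mul_of_nonneg_left (hC _ (hmem x hx _ (hcirc θ))) (norm_nonneg _)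
    · exact (hk.norm.mul continuous_const).intervalIntegrable _ _
    · refine Eventually.of_forall fun θ _ x hx => ?_
      exact ((hasFDerivAt_comp_add_right _).2 (hfd _ (hmem x hx _ (hcirc θ)))).const_smul (k θ)
  refine (key.differentiableAt.const_smul (2 * Real.pi * Complex.I : ℂ)⁻¹).congr_of_eventuallyEq ?_
  filter_upwards [hball] with x hx
  have hline : ∀ ζ : ℂ, HasDerivAt (fun ζ : ℂ => x + ζ • v) v ζ := fun ζ => by
    simpa using ((hasDerivAt_id ζ).smul_const v).const_add x
  have hV : IsOpen ((fun ζ : ℂ => x + ζ • v) ⁻¹' ball x₀ R) :=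
    isOpen_ball.preimage (by fun_prop)
  have h1 := Complex.two_pi_I_inv_smul_circleIntegral_sub_sq_inv_smul_of_differentiable
    (f := fun ζ : ℂ => f (x + ζ • v)) hV (c := 0) (R := ρ) (fun ζ hζ => hmem x hx ζ hζ)
    (fun ζ hζ => ((hfd _ hζ).comp_hasDerivAt ζ (hline ζ)).differentiableAt.differentiableWithinAt)
    (mem_ball_self hρ)
  have h2 : deriv (fun ζ : ℂ => f (x + ζ • v)) 0 = fderiv ℂ f x v := by
    have h3 := hfd _ (hmem x hx 0 (by simp [hρ.le]))
    have h4 := (h3.comp_hasDerivAt (0 : ℂ) (hline 0)).deriv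
    simpa [Function.comp_def] using h4
  rw [← h2, ← h1]
  simp only [circleIntegral, smul_smul, Pi.smul_apply, k]

/-- The derivative of a holomorphic map of several variables is holomorphic. -/
theorem differentiableOn_fderiv {E F : Type*} [NormedAddCommGroup E]
    [NormedSpace ℂ E] [FiniteDimensional ℂ E] [NormedAddCommGroup F] [NormedSpace ℂ F]
    [CompleteSpace F] [SecondCountableTopology F] {f : E → F} {U : Set E} (hU : IsOpen U)
    (hf : DifferentiableOn ℂ f U) :
    DifferentiableOn ℂ (fderiv ℂ f) U := by
  let b := Module.finBasis ℂ E
  have h : fderiv ℂ f = fun x => ∑ i, ((LinearMap.toContinuousLinearMap (b.coord i)).smulRight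
      (fderiv ℂ f x (b i))) := by
    ext x v
    conv_lhs => rw [← b.sum_repr v]
    simp only [map_sum, map_smul, FunLike.coe_sum, Finset.sum_apply]
    simp
  rw [h]
  refine DifferentiableOn.fun_sum fun i _ => ?_
  have := differentiableOn_fderiv_apply hU hf (b i)
  exact ((ContinuousLinearMap.smulRightL ℂ E F
    (LinearMap.toContinuousLinearMap (b.coord i))).differentiable.comp_differentiableOn this)

/-- A holomorphic map of several variables is smooth. -/
theorem contDiffOn_of_differentiableOn_complex {E F : Type u} [NormedAddCommGroup E]
    [NormedSpace ℂ E] [FiniteDimensional ℂ E] [NormedAddCommGroup F] [NormedSpace ℂ F]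
    [CompleteSpace F] [SecondCountableTopology F] {f : E → F} {U : Set E} (hU : IsOpen U)
    (hf : DifferentiableOn ℂ f U) (m : ℕ) : ContDiffOn ℂ m f U := by
  -- The induction replaces `F` by `E →L[ℂ] F`; hence the common universe of `E` and `F`.
  induction m generalizing F with
  | zero => exact contDiffOn_zero.2 hf.continuousOn
  | succ m ih =>
    push_cast
    rw [contDiffOn_succ_iff_fderiv_of_isOpen hU]
    exact ⟨hf, by simp, ih (differentiableOn_fderiv hU hf)⟩

/-! ### Taylor expansion along complex lines. -/

/-- A polynomial of degree less than `N` that is `O(ζ ^ N)` at the origin vanishes. -/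
theorem coeff_eq_zero_of_isBigO {N : ℕ} {c : ℕ → ℂ}
    (h : (fun ζ : ℂ => ∑ m ∈ Finset.range N, c m * ζ ^ m) =O[𝓝[≠] 0] fun ζ => ζ ^ N) :
    ∀ m < N, c m = 0 := by
  induction N generalizing c with
  | zero => simp
  | succ N ih =>
    have hid : Tendsto (fun ζ : ℂ => ζ) (𝓝[≠] 0) (𝓝 0) := tendsto_id.mono_left nhdsWithin_le_nhds
    have h1 : Tendsto (fun ζ : ℂ => ∑ m ∈ Finset.range (N + 1), c m * ζ ^ m) (𝓝[≠] 0) (𝓝 0) := by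
      refine h.trans_tendsto ?_
      simpa using hid.pow (N + 1)
    have h2 : Tendsto (fun ζ : ℂ => ∑ m ∈ Finset.range (N + 1), c m * ζ ^ m) (𝓝[≠] 0)
        (𝓝 (∑ m ∈ Finset.range (N + 1), c m * 0 ^ m)) :=
      tendsto_finsetSum _ fun m _ => (hid.pow m).const_mul (c m)
    have h0 : c 0 = 0 := by
      have := tendsto_nhds_unique h2 h1
      simpa [Finset.sum_range_succ'] using this
    have h3 : ∀ m < N, c (m + 1) = 0 := by
      refine ih (c := fun m => c (m + 1)) ?_
      have h4 := (isBigO_refl (fun ζ : ℂ => ζ⁻¹) (𝓝[≠] 0)).mul h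
      refine h4.congr' ?_ ?_
      · filter_upwards [self_mem_nhdsWithin] with ζ hζ
        rw [Set.mem_compl_singleton_iff] at hζ
        rw [Finset.sum_range_succ', h0]
        simp only [zero_mul, add_zero, Finset.mul_sum]
        refine Finset.sum_congr rfl fun m _ => ?_
        field_simp
        ring
      · filter_upwards [self_mem_nhdsWithin] with ζ hζ
        rw [Set.mem_compl_singleton_iff] at hζ
        field_simp
        ring
    intro m hm
    cases m with
    | zero => exact h0
    | succ m => exact h3 m (by omega)

section Expansion

variable {X : Type u} [NormedAddCommGroup X] [NormedSpace ℂ X] [FiniteDimensional ℂ X]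

theorem homogeneousPart_eq_iteratedDeriv {f : X → X} (hf : DifferentiableOn ℂ f (ball 0 1))
    (m : ℕ) (z : X) :
    homogeneousPart f m z
      = ((m.factorial : ℂ)⁻¹) • iteratedDeriv m (fun ζ : ℂ => f (ζ • z)) 0 := by
  have : ProperSpace X := FiniteDimensional.proper ℂ X
  have : CompleteSpace X := FiniteDimensional.complete ℂ X
  have hs : IsOpen (ball (0 : X) 1) := isOpen_ball
  let g : ℂ →L[ℂ] X := (ContinuousLinearMap.id ℂ ℂ).smulRight z
  have hg : IsOpen (g ⁻¹' ball (0 : X) 1) := hs.preimage g.continuous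
  have h := g.iteratedFDerivWithin_comp_right
    (contDiffOn_of_differentiableOn_complex hs hf m) hs.uniqueDiffOn hg.uniqueDiffOn
    (x := 0) (by simp) le_rfl
  rw [iteratedFDerivWithin_of_isOpen m hg (by simp),
    iteratedFDerivWithin_of_isOpen m hs (by simp)] at h
  have hfun : (fun ζ : ℂ => f (ζ • z)) = f ∘ g := by ext1 ζ; simp [g]
  rw [homogeneousPart, hfun, iteratedDeriv_eq_iteratedFDeriv, h]
  simp [g]

/-- Taylor expansion of a holomorphic map along complex lines through the origin. -/
theorem isBigO_line_sub_sum_homogeneousPart {f : X → X}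
    (hf : DifferentiableOn ℂ f (ball 0 1)) (z : X) (N : ℕ) :
    (fun ζ : ℂ => f (ζ • z) - ∑ m ∈ Finset.range N, ζ ^ m • homogeneousPart f m z)
      =O[𝓝 0] fun ζ => ζ ^ N := by
  have : CompleteSpace X := FiniteDimensional.complete ℂ X
  have hd : AnalyticAt ℂ (fun ζ : ℂ => f (ζ • z)) 0 := by
    have hV : IsOpen ((fun ζ : ℂ => ζ • z) ⁻¹' ball (0 : X) 1) :=
      isOpen_ball.preimage (by fun_prop)
    refine DifferentiableOn.analyticAt (s := (fun ζ : ℂ => ζ • z) ⁻¹' ball (0 : X) 1) ?_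
      (hV.mem_nhds (by simp))
    exact hf.comp (by fun_prop) fun ζ hζ => hζ
  obtain ⟨p, r, hpr⟩ := hd
  have hp : HasFPowerSeriesAt (fun ζ : ℂ => f (ζ • z)) p 0 := ⟨r, hpr⟩
  have h := hp.isBigO_sub_partialSum_pow N
  refine (h.congr' (Eventually.of_forall fun ζ => ?_) (EventuallyEq.rfl)).trans
    (IsBigO.of_bound 1 (by simp))
  simp only [zero_add, FormalMultilinearSeries.partialSum]
  congr 1
  refine Finset.sum_congr rfl fun m _ => ?_
  rw [homogeneousPart_eq_iteratedDeriv hf, iteratedDeriv_eq_iteratedFDeriv, ← hpr.factorial_smul,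
    ← Nat.cast_smul_eq_nsmul ℂ, inv_smul_smul₀ (by exact_mod_cast m.factorial_ne_zero),
    FormalMultilinearSeries.apply_eq_pow_smul_coeff]
  rfl

end Expansion

/-! ### Orders of vanishing at the origin. -/

section Order

variable {E F : Type*} [NormedAddCommGroup E] [NormedSpace ℂ E] [NormedAddCommGroup F]
  [NormedSpace ℂ F]

/-- A holomorphic map that vanishes to order `N + 1` along all complex lines through the origin
does so uniformly. -/
theorem isBigO_norm_pow_of_forall_line {h : E → F} (hh : DifferentiableOn ℂ h (ball 0 1)) {N : ℕ}
    (hline : ∀ z ∈ ball (0 : E) 1, (fun ζ : ℂ => h (ζ • z)) =O[𝓝 0] fun ζ => ζ ^ (N + 1)) :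
    h =O[𝓝 0] fun x => ‖x‖ ^ (N + 1) := by
  have h0 : h 0 = 0 := by
    have h1 := hline 0 (by simp)
    have h2 : Tendsto (fun ζ : ℂ => h (ζ • (0 : E))) (𝓝 0) (𝓝 0) := by
      refine h1.trans_tendsto ?_
      simpa using (tendsto_id (α := ℂ) (x := 𝓝 0)).pow (N + 1)
    simpa using h2
  have hc : ContinuousAt h 0 :=
    (hh.differentiableAt (ball_mem_nhds 0 one_pos)).continuousAt
  have h1 : ∀ᶠ x in 𝓝 (0 : E), x ∈ ball (0 : E) 1 ∧ dist (h x) (h 0) < 1 :=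
    Filter.Eventually.and (ball_mem_nhds 0 one_pos) (hc (ball_mem_nhds _ one_pos))
  obtain ⟨r, hr, hball⟩ := Metric.eventually_nhds_iff_ball.1 h1
  refine IsBigO.of_bound ((1 / r) ^ (N + 1)) ?_
  filter_upwards [ball_mem_nhds (0 : E) hr] with x hx
  rcases eq_or_ne x 0 with rfl | hx0
  · simp [h0]
  have hxn : 0 < ‖x‖ := norm_pos_iff.2 hx0
  have hxr : ‖x‖ < r := by simpa using hx
  have hmaps : ∀ ζ ∈ ball (0 : ℂ) (r / ‖x‖), ζ • x ∈ ball (0 : E) r := by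
    intro ζ hζ
    rw [mem_ball_zero_iff] at hζ ⊢
    rw [norm_smul]
    exact (lt_div_iff₀ hxn).1 hζ
  -- Schwarz lemma for a zero of order N + 1, on the disc of radius r/‖x‖ and evaluated at ζ = 1.
  -- The resulting bound (‖x‖/r)^(N+1) does not depend on the direction of x.
  have key := Complex.dist_le_mul_div_pow_of_mapsTo_ball_of_isLittleO
    (f := fun ζ : ℂ => h (ζ • x)) (c := 0) (z := 1) (R₁ := r / ‖x‖) (R₂ := 1) (n := N)
    (hh.comp (by fun_prop) fun ζ hζ => (hball _ (hmaps ζ hζ)).1)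
    (fun ζ hζ => by simpa using (hball _ (hmaps ζ hζ)).2.le) ?_
    (by simpa using (one_lt_div hxn).2 hxr)
  · simpa [h0, div_pow, mul_comm, div_eq_mul_inv, mul_pow] using key
  · have h2 := hline x (hball x hx).1
    simp only [zero_smul, h0, sub_zero]
    refine h2.trans_isLittleO ?_
    have h3 : (fun ζ : ℂ => ζ ^ (N + 1)) =o[𝓝 0] fun ζ : ℂ => ζ ^ N :=
      isLittleO_pow_pow (Nat.lt_succ_self N)
    simpa [norm_pow] using h3.norm_right

/-- Cauchy estimate for the order of vanishing of the derivative. -/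
theorem isBigO_fderiv_of_isBigO_norm_pow {h : E → F} (hh : DifferentiableOn ℂ h (ball 0 1)) {N : ℕ}
    (hO : h =O[𝓝 0] fun x => ‖x‖ ^ (N + 1)) :
    fderiv ℂ h =O[𝓝[≠] 0] fun x => ‖x‖ ^ N := by
  obtain ⟨C, hC⟩ := hO.bound
  have hU : ∀ᶠ x in 𝓝 (0 : E), x ∈ ball (0 : E) 1 ∧ ‖h x‖ ≤ C * ‖‖x‖ ^ (N + 1)‖ :=
    Filter.Eventually.and (ball_mem_nhds 0 one_pos) hC
  obtain ⟨r, hr, hball⟩ := Metric.eventually_nhds_iff_ball.1 hU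
  -- On the ball of radius ‖x‖ about x, the oscillation of h from h(x) is at most 2|C|(2‖x‖)^(N+1);
  -- the Cauchy estimate divides this by ‖x‖.
  refine IsBigO.of_bound (2 * |C| * 2 ^ (N + 1)) ?_
  filter_upwards [self_mem_nhdsWithin, nhdsWithin_le_nhds (ball_mem_nhds (0 : E) (half_pos hr))]
    with x hx0 hx
  have hxn : 0 < ‖x‖ := norm_pos_iff.2 hx0
  have hxr : ‖x‖ < r / 2 := by simpa using hx
  have hsub : ∀ y ∈ ball x ‖x‖, y ∈ ball (0 : E) r ∧ ‖y‖ ≤ 2 * ‖x‖ := by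
    intro y hy
    have h1 : ‖y‖ < 2 * ‖x‖ := by
      have := norm_sub_norm_le y x
      rw [mem_ball, dist_eq_norm] at hy
      linarith
    exact ⟨by rw [mem_ball_zero_iff]; linarith, h1.le⟩
  have hb : ∀ y ∈ ball x ‖x‖, ‖h y‖ ≤ |C| * (2 * ‖x‖) ^ (N + 1) := by
    intro y hy
    refine (hball y (hsub y hy).1).2.trans ?_
    rw [Real.norm_of_nonneg (by positivity)]
    have h1 : ‖y‖ ^ (N + 1) ≤ (2 * ‖x‖) ^ (N + 1) := by
      gcongr
      exact (hsub y hy).2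
    exact (mul_le_mul_of_nonneg_right (le_abs_self C) (by positivity)).trans
      (mul_le_mul_of_nonneg_left h1 (abs_nonneg C))
  have key := Complex.norm_fderiv_le_div_of_mapsTo_ball (f := h) (c := x) (R₁ := ‖x‖)
    (R₂ := 2 * (|C| * (2 * ‖x‖) ^ (N + 1)))
    (hh.mono fun y hy => (hball y (hsub y hy).1).1) (fun y hy => by
      rw [mem_closedBall, dist_eq_norm]
      linarith [norm_sub_le (h y) (h x), hb y hy, hb x (mem_ball_self hxn)]) hxn
  refine key.trans_eq ?_
  rw [Real.norm_of_nonneg (by positivity), mul_pow, pow_succ ‖x‖]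
  field_simp

end Order

/-! ### Schur parameters and the sharp coefficient functional. -/

/-- Möbius transformations `w ↦ (w - a) / (1 - conj a w)` do not increase the norm above one. -/
theorem Complex.norm_sub_le_norm_one_sub_conj_mul {a w : ℂ} (ha : ‖a‖ ≤ 1) (hw : ‖w‖ ≤ 1) :
    ‖w - a‖ ≤ ‖1 - conj a * w‖ := by
  have h1 : Complex.normSq (w - a) ≤ Complex.normSq (1 - conj a * w) := by
    have ha' : Complex.normSq a ≤ 1 := by
      rw [Complex.normSq_eq_norm_sq]; exact pow_le_one₀ (norm_nonneg _) ha
    have hw' : Complex.normSq w ≤ 1 := by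
      rw [Complex.normSq_eq_norm_sq]; exact pow_le_one₀ (norm_nonneg _) hw
    have h := mul_nonneg (sub_nonneg.2 ha') (sub_nonneg.2 hw')
    simp only [Complex.normSq_apply, Complex.sub_re, Complex.sub_im, Complex.mul_re,
      Complex.mul_im, Complex.one_re, Complex.one_im, Complex.conj_re, Complex.conj_im] at h ⊢
    nlinarith
  rw [Complex.normSq_eq_norm_sq, Complex.normSq_eq_norm_sq] at h1
  exact (sq_le_sq₀ (norm_nonneg _) (norm_nonneg _)).1 h1

/-- One step of the Schur algorithm. -/
theorem exists_schur_step {φ : ℂ → ℂ} (hφ : DifferentiableOn ℂ φ (ball 0 1))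
    (hb : ∀ ζ ∈ ball (0 : ℂ) 1, ‖φ ζ‖ ≤ 1) :
    ∃ ψ : ℂ → ℂ, DifferentiableOn ℂ ψ (ball 0 1) ∧ (∀ ζ ∈ ball (0 : ℂ) 1, ‖ψ ζ‖ ≤ 1) ∧
      ∀ ζ ∈ ball (0 : ℂ) 1, φ ζ = φ 0 + ζ * ψ ζ * (1 - conj (φ 0) * φ ζ) := by
  have h0 : (0 : ℂ) ∈ ball (0 : ℂ) 1 := by simp
  -- A unimodular value at the centre forces φ to be constant, and the algorithm stops with ψ = 0.
  -- The division-free form of the identity covers this case too.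
  by_cases h1 : ‖φ 0‖ = 1
  · refine ⟨fun _ => 0, differentiableOn_const _, by simp, fun ζ hζ => ?_⟩
    have hmax : IsMaxOn (norm ∘ φ) (ball (0 : ℂ) 1) 0 := fun z hz => by
      simpa [h1] using hb z hz
    have := Complex.eqOn_of_isPreconnected_of_isMaxOn_norm
      (convex_ball (0 : ℂ) 1).isPreconnected isOpen_ball hφ h0 hmax hζ
    simpa using this
  have h2 : ‖φ 0‖ < 1 := lt_of_le_of_ne (hb 0 h0) h1
  have hne : ∀ ζ ∈ ball (0 : ℂ) 1, 1 - conj (φ 0) * φ ζ ≠ 0 := by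
    intro ζ hζ h
    have h3 : ‖conj (φ 0) * φ ζ‖ = 1 := by rw [← sub_eq_zero.1 h, norm_one]
    rw [norm_mul, RCLike.norm_conj] at h3
    nlinarith [hb ζ hζ, norm_nonneg (φ 0), norm_nonneg (φ ζ)]
  let g : ℂ → ℂ := fun ζ => (φ ζ - φ 0) / (1 - conj (φ 0) * φ ζ)
  have hg : DifferentiableOn ℂ g (ball 0 1) :=
    (hφ.sub_const _).div ((differentiableOn_const _).sub ((differentiableOn_const _).mul hφ)) hne
  have hg0 : g 0 = 0 := by simp [g]
  have hgb : Set.MapsTo g (ball 0 1) (closedBall (g 0) 1) := fun ζ hζ => by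
    rw [hg0, mem_closedBall_zero_iff, norm_div, div_le_one (norm_pos_iff.2 (hne ζ hζ))]
    exact Complex.norm_sub_le_norm_one_sub_conj_mul h2.le (hb ζ hζ)
  refine ⟨dslope g 0, (Complex.differentiableOn_dslope (ball_mem_nhds 0 one_pos)).2 hg,
    fun ζ hζ => by simpa using Complex.norm_dslope_le_div_of_mapsTo_ball hg hgb hζ,
    fun ζ hζ => ?_⟩
  have h3 : ζ * dslope g 0 ζ = g ζ := by
    simpa [hg0] using sub_smul_dslope g 0 ζ
  rw [h3, div_mul_cancel₀ _ (hne ζ hζ)]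
  ring

/-- Schur's parametrization of the first three Taylor coefficients of a holomorphic
self-map of the closed unit disc. -/
theorem exists_schur_parameters {φ : ℂ → ℂ} (hφ : DifferentiableOn ℂ φ (ball 0 1))
    (hb : ∀ ζ ∈ ball (0 : ℂ) 1, ‖φ ζ‖ ≤ 1) :
    ∃ (c s t : ℂ) (r : ℂ → ℂ), ‖c‖ ≤ 1 ∧ ‖s‖ ≤ 1 ∧ ‖t‖ ≤ 1 ∧ DifferentiableAt ℂ r 0 ∧
      r 0 = (1 - conj c * c) * (t * (1 - conj s * s) - conj c * s ^ 2) ∧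
      ∀ ζ ∈ ball (0 : ℂ) 1, φ ζ = c + (1 - conj c * c) * s * ζ + r ζ * ζ ^ 2 := by
  obtain ⟨ψ, hψ, hψb, hψe⟩ := exists_schur_step hφ hb
  obtain ⟨χ, hχ, hχb, hχe⟩ := exists_schur_step hψ hψb
  have h0 : (0 : ℂ) ∈ ball (0 : ℂ) 1 := by simp
  have hball : ball (0 : ℂ) 1 ∈ 𝓝 0 := ball_mem_nhds 0 one_pos
  have dφ := hφ.differentiableAt hball
  have dψ := hψ.differentiableAt hball
  have dχ := hχ.differentiableAt hball
  refine ⟨φ 0, ψ 0, χ 0, fun ζ => χ ζ * (1 - conj (ψ 0) * ψ ζ) * (1 - conj (φ 0) * φ ζ)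
    - ψ 0 * conj (φ 0) * ψ ζ * (1 - conj (φ 0) * φ ζ), hb 0 h0, hψb 0 h0, hχb 0 h0,
    by fun_prop, by ring, fun ζ hζ => ?_⟩
  have e1 := hψe ζ hζ
  have e2 := hχe ζ hζ
  linear_combination e1 + ζ * (1 - conj (φ 0) * φ ζ) * e2 - ζ * ψ 0 * conj (φ 0) * e1

/-- A sharp bound for the quadratic expression in the Schur parameters `c`, `s` that arises from
the fourth Taylor coefficient. -/
theorem norm_schur_quadratic_le {m ν δ u : ℝ} (hν : 0 < ν) (hu : 0 ≤ u) (hδ : 0 ≤ δ)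
    (hm : m ^ 2 = 4 * ν * (1 + δ)) (c s : ℂ) (hc : u = 1 - ‖c‖ ^ 2) :
    ‖(u : ℂ) * conj c * s ^ 2 + m * c * u * s - ν * c ^ 3‖
      ≤ (u * ‖s‖ ^ 2 + ν * ‖c‖ ^ 2) * (1 + u * δ / 2) := by
  refine (sq_le_sq₀ (norm_nonneg _) (by positivity)).1 ?_
  rw [← Complex.normSq_eq_norm_sq]
  -- With X = Re(s c̄²) one has Re(s² c̄⁴) = 2X² - |s|²|c|⁴, so the squared modulus is a quadratic
  -- polynomial in X; completing the square leaves exactly the right-hand side.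
  have key : 4 * ν * ((u * ‖s‖ ^ 2 + ν * ‖c‖ ^ 2) ^ 2 * (‖c‖ ^ 2 + m ^ 2 * u / (4 * ν))
      - Complex.normSq ((u : ℂ) * conj c * s ^ 2 + m * c * u * s - ν * c ^ 3))
      = u * (m * (u * ‖s‖ ^ 2 - ν * ‖c‖ ^ 2) - 4 * ν * (s * conj c ^ 2).re) ^ 2 := by
    have : 4 * ν * (‖c‖ ^ 2 + m ^ 2 * u / (4 * ν)) = 4 * ν * ‖c‖ ^ 2 + m ^ 2 * u := by
      field_simp
    rw [mul_sub, mul_left_comm, this, ← Complex.normSq_eq_norm_sq, ← Complex.normSq_eq_norm_sq]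
    simp only [Complex.normSq_apply, Complex.sub_re, Complex.sub_im, Complex.mul_re,
      Complex.mul_im, Complex.add_re, Complex.add_im, Complex.conj_re, Complex.conj_im,
      Complex.ofReal_re, Complex.ofReal_im, pow_succ, pow_zero, one_mul]
    ring
  have h1 : Complex.normSq ((u : ℂ) * conj c * s ^ 2 + m * c * u * s - ν * c ^ 3)
      ≤ (u * ‖s‖ ^ 2 + ν * ‖c‖ ^ 2) ^ 2 * (‖c‖ ^ 2 + m ^ 2 * u / (4 * ν)) := by
    have h2 : 0 ≤ u * (m * (u * ‖s‖ ^ 2 - ν * ‖c‖ ^ 2) - 4 * ν * (s * conj c ^ 2).re) ^ 2 := by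
      positivity
    rw [← key] at h2
    nlinarith [(mul_nonneg_iff_of_pos_left (by positivity : 0 < 4 * ν)).1 h2]
  refine h1.trans ?_
  rw [mul_pow]
  refine mul_le_mul_of_nonneg_left ?_ (by positivity)
  -- Since |c|² = 1 - u, the last factor becomes 1 + uδ, which is at most (1 + uδ/2)².
  have h3 : m ^ 2 * u / (4 * ν) = (1 + δ) * u := by rw [hm]; field_simp
  rw [h3]
  nlinarith [sq_nonneg (u * δ)]

/-- Sharp bound for a cubic functional on the first three Taylor coefficients
of holomorphic self-maps of the disc, in terms of the Schur parameters. -/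
theorem norm_schur_functional_le {β : ℝ} (h₀ : 56 / 95 ≤ β) {c s t : ℂ}
    (hc : ‖c‖ ≤ 1) (hs : ‖s‖ ≤ 1) (ht : ‖t‖ ≤ 1) :
    ‖(1 - conj c * c) * (t * (1 - conj s * s) - conj c * s ^ 2)
      - (7 * β - 2) * c * ((1 - conj c * c) * s)
      + (3 * β - 1) * (4 * β - 1) * c ^ 3‖ ≤ (3 * β - 1) * (4 * β - 1) := by
  set ν : ℝ := (3 * β - 1) * (4 * β - 1) with hν
  set u : ℝ := 1 - ‖c‖ ^ 2 with hu
  set w : ℝ := 1 - ‖s‖ ^ 2 with hw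
  -- This is 12β² - 7β ≥ β²/8, which for β > 0 means exactly β ≥ 56/95.
  have hν1 : 1 + β ^ 2 / 8 ≤ ν := by rw [hν]; nlinarith
  have hν0 : 0 < ν := by nlinarith [sq_nonneg β]
  have hu0 : 0 ≤ u := by rw [hu]; nlinarith [norm_nonneg c]
  have hw0 : 0 ≤ w := by rw [hw]; nlinarith [norm_nonneg s]
  have hcu : 1 - conj c * c = (u : ℂ) := by
    rw [Complex.conj_mul', hu]; push_cast; ring
  have hsw : 1 - conj s * s = (w : ℂ) := by
    rw [Complex.conj_mul', hw]; push_cast; ring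
  -- This δ comes from (7β - 2)² = 4ν + β².
  have hδ : 4 * ν * (β ^ 2 / (4 * ν)) = β ^ 2 := by field_simp
  have hq := norm_schur_quadratic_le (m := 7 * β - 2) (δ := β ^ 2 / (4 * ν)) hν0 hu0
    (by positivity) (by rw [mul_add, hδ, hν]; ring) c s hu
  set δ : ℝ := β ^ 2 / (4 * ν)
  have hsplit : (1 - conj c * c) * (t * (1 - conj s * s) - conj c * s ^ 2)
      - (7 * β - 2) * c * ((1 - conj c * c) * s) + (3 * β - 1) * (4 * β - 1) * c ^ 3
      = (u * w : ℝ) * t - ((u : ℂ) * conj c * s ^ 2 + ((7 * β - 2 : ℝ) : ℂ) * c * u * s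
        - ν * c ^ 3) := by
    rw [hcu, hsw, hν]; push_cast; ring
  rw [hsplit]
  have h1 : ‖((u * w : ℝ) : ℂ) * t‖ ≤ u * w := by
    rw [norm_mul, Complex.norm_real, Real.norm_of_nonneg (by positivity)]
    exact mul_le_of_le_one_right (by positivity) ht
  refine (norm_sub_le _ _).trans ((add_le_add h1 hq).trans ?_)
  have h2 : u * ‖s‖ ^ 2 + ν * ‖c‖ ^ 2 ≤ ν := by
    have : u * ‖s‖ ^ 2 ≤ u := mul_le_of_le_one_right hu0 (pow_le_one₀ (norm_nonneg _) hs)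
    nlinarith [sq_nonneg β]
  have h3 : (u * ‖s‖ ^ 2 + ν * ‖c‖ ^ 2) * (u * δ / 2) ≤ ν * (u * δ / 2) :=
    mul_le_mul_of_nonneg_right h2 (by positivity)
  have h4 : ν * (u * δ / 2) = u * (β ^ 2 / 8) := by linear_combination u / 8 * hδ
  -- The sum of the bounds is at most u + ν(1 - u) + uβ²/8 = ν - u(ν - 1 - β²/8).
  nlinarith [mul_le_mul_of_nonneg_left hν1 hu0]

/-! ### The coefficient problem in one variable. -/

/-- Functions on the disc with real part at least `α`, via the Cayley transform and the
Schwarz lemma. -/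
theorem exists_schwarz_of_le_re {p : ℂ → ℂ} {α : ℝ} (hα : α < 1)
    (hp : DifferentiableOn ℂ p (ball 0 1)) (hp0 : p 0 = 1)
    (hre : ∀ ζ ∈ ball (0 : ℂ) 1, α ≤ (p ζ).re) :
    ∃ φ : ℂ → ℂ, DifferentiableOn ℂ φ (ball 0 1) ∧ (∀ ζ ∈ ball (0 : ℂ) 1, ‖φ ζ‖ ≤ 1) ∧
      ∀ ζ ∈ ball (0 : ℂ) 1, p ζ * (1 - ζ * φ ζ) = 1 + (1 - 2 * α) * ζ * φ ζ := by
  have hne : ∀ ζ ∈ ball (0 : ℂ) 1, p ζ + (1 - 2 * α) ≠ 0 := by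
    intro ζ hζ h
    have h1 := congrArg Complex.re h
    simp at h1
    linarith [hre ζ hζ]
  let w : ℂ → ℂ := fun ζ => (p ζ - 1) / (p ζ + (1 - 2 * α))
  have hw0 : w 0 = 0 := by simp [w, hp0]
  -- Because w(0) = 0, the Schur step is here the Schwarz lemma w = ζφ.
  obtain ⟨φ, hφ, hφb, hφe⟩ := exists_schur_step (φ := w)
    ((hp.sub_const _).div (hp.add_const _) hne) (fun ζ hζ => by
      rw [norm_div, div_le_one (norm_pos_iff.2 (hne ζ hζ)),
        ← sq_le_sq₀ (norm_nonneg _) (norm_nonneg _), ← Complex.normSq_eq_norm_sq,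
        ← Complex.normSq_eq_norm_sq, Complex.normSq_apply, Complex.normSq_apply]
      simp only [Complex.sub_re, Complex.sub_im, Complex.add_re, Complex.add_im, Complex.one_re,
        Complex.one_im, Complex.mul_re, Complex.mul_im, Complex.ofReal_re, Complex.ofReal_im,
        Complex.re_ofNat, Complex.im_ofNat]
      nlinarith [mul_nonneg (sub_nonneg.2 (hre ζ hζ)) (sub_pos.2 hα).le])
  refine ⟨φ, hφ, hφb, fun ζ hζ => ?_⟩
  have h := hφe ζ hζ
  rw [hw0] at h
  simp only [map_zero, zero_mul, sub_zero, mul_one, zero_add, w] at h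
  rw [div_eq_iff (hne ζ hζ)] at h
  linear_combination h

/-- The sharp coefficient estimate in one variable. -/
theorem norm_coeff_le_of_le_re {p : ℂ → ℂ} {α : ℝ} (hα : α ≤ 39 / 95)
    (hp : DifferentiableOn ℂ p (ball 0 1)) (hp0 : p 0 = 1)
    (hre : ∀ ζ ∈ ball (0 : ℂ) 1, α ≤ (p ζ).re) {A B P : ℂ}
    (hO : (fun ζ : ℂ => p ζ * (1 + 2 * A * ζ + 3 * B * ζ ^ 2)
      - (1 + A * ζ + B * ζ ^ 2 - 3 * P * ζ ^ 3)) =O[𝓝[≠] 0] fun ζ => ζ ^ 4) :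
    ‖P‖ ≤ (1 - α) * (3 - 4 * α) * (4 - 6 * α) / 3 := by
  obtain ⟨φ, hφ, hφb, hφe⟩ := exists_schwarz_of_le_re (by linarith) hp hp0 hre
  obtain ⟨c, s, t, r, hc, hs, ht, hr, hr0, hφr⟩ := exists_schur_parameters hφ hφb
  have hball : ball (0 : ℂ) 1 ∈ 𝓝[≠] (0 : ℂ) := nhdsWithin_le_nhds (ball_mem_nhds 0 one_pos)
  set γ : ℂ := 1 - 2 * α with hγ
  set c₁ : ℂ := (1 - conj c * c) * s with hc₁
  have hbdd : ∀ {g : ℂ → ℂ}, ContinuousAt g 0 → g =O[𝓝[≠] 0] fun _ => (1 : ℂ) := fun hg =>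
    (hg.tendsto.isBigO_one ℂ).mono nhdsWithin_le_nhds
  have hrc : ContinuousAt r 0 := hr.continuousAt
  have h1 : (fun ζ : ℂ => 1 - ζ * φ ζ) =O[𝓝[≠] 0] fun _ => (1 : ℂ) := by
    have : ContinuousAt φ 0 := (hφ.differentiableAt (ball_mem_nhds 0 one_pos)).continuousAt
    exact hbdd (by fun_prop)
  -- Multiplication by 1 - ζφ clears the denominator of p. Then `h3` freezes r at 0, `h5` absorbs
  -- the terms of order at least four, and a cubic polynomial with coefficients `e` remains.
  have h2 := h1.mul hO
  have h3 : (fun ζ : ℂ => (γ + 1) * (r ζ - r 0) * ζ ^ 3) =O[𝓝[≠] 0] fun ζ => ζ ^ 4 := by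
    have h4 := ((hr.isBigO_sub.mono nhdsWithin_le_nhds).const_mul_left (γ + 1)).mul
      (isBigO_refl (fun ζ : ℂ => ζ ^ 3) (𝓝[≠] 0))
    refine h4.congr_right fun ζ => by ring
  have h5 : (fun ζ : ℂ => ((2 * γ + 1) * A * r ζ + (3 * γ + 1) * B * (c₁ + r ζ * ζ)
      - 3 * P * (c + c₁ * ζ + r ζ * ζ ^ 2)) * ζ ^ 4) =O[𝓝[≠] 0] fun ζ => ζ ^ 4 := by
    have h6 := (hbdd (g := fun ζ : ℂ => (2 * γ + 1) * A * r ζ + (3 * γ + 1) * B * (c₁ + r ζ * ζ)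
      - 3 * P * (c + c₁ * ζ + r ζ * ζ ^ 2)) (by fun_prop)).mul
      (isBigO_refl (fun ζ : ℂ => ζ ^ 4) (𝓝[≠] 0))
    simpa using h6
  let e : ℕ → ℂ := fun m => if m = 1 then A + (γ + 1) * c
    else if m = 2 then 2 * B + (γ + 1) * c₁ + (2 * γ + 1) * A * c
    else if m = 3 then 3 * P + (γ + 1) * r 0 + (2 * γ + 1) * A * c₁ + (3 * γ + 1) * B * c else 0
  have he : ∀ m < 4, e m = 0 := by
    refine coeff_eq_zero_of_isBigO ((((h2.congr_right fun ζ => by ring).sub h3).sub h5).congr'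
      ?_ EventuallyEq.rfl)
    filter_upwards [hball] with ζ hζ
    simp only [Finset.sum_range_succ, Finset.sum_range_zero, e]
    norm_num
    have e1 := hφe ζ hζ
    have e2 := hφr ζ hζ
    rw [e2] at e1 ⊢
    linear_combination (1 + 2 * A * ζ + 3 * B * ζ ^ 2) * e1
  have e1 : A + (γ + 1) * c = 0 := by simpa [e] using he 1 (by norm_num)
  have e2 : 2 * B + (γ + 1) * c₁ + (2 * γ + 1) * A * c = 0 := by
    simpa [e] using he 2 (by norm_num)
  have e3 : 3 * P + (γ + 1) * r 0 + (2 * γ + 1) * A * c₁ + (3 * γ + 1) * B * c = 0 := by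
    simpa [e] using he 3 (by norm_num)
  have hfun := norm_schur_functional_le (β := 1 - α) (by linarith) hc hs ht
  rw [← hr0, ← hc₁] at hfun
  have hP : P = ((-(2 * (1 - α) / 3) : ℝ) : ℂ) * (r 0 - (7 * ((1 - α : ℝ) : ℂ) - 2) * c * c₁
      + (3 * ((1 - α : ℝ) : ℂ) - 1) * (4 * ((1 - α : ℝ) : ℂ) - 1) * c ^ 3) := by
    have hA : A = -(γ + 1) * c := by linear_combination e1
    have hB : B = -((γ + 1) * c₁ + (2 * γ + 1) * A * c) / 2 := by linear_combination e2 / 2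
    have hP' : P = -((γ + 1) * r 0 + (2 * γ + 1) * A * c₁ + (3 * γ + 1) * B * c) / 3 := by
      linear_combination e3 / 3
    rw [hP', hB, hA, hγ]
    push_cast
    ring
  rw [hP, norm_mul, Complex.norm_real, norm_neg, Real.norm_of_nonneg (by linarith)]
  refine (mul_le_mul_of_nonneg_left hfun (by linarith)).trans_eq ?_
  ring

/-! ### The field (Df)⁻¹f along lines. -/

section Normed

variable {X : Type*} [NormedAddCommGroup X] [NormedSpace ℂ X]

theorem homogeneousPart_smul (f : X → X) (m : ℕ) (c : ℂ) (z : X) :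
    homogeneousPart f m (c • z) = c ^ m • homogeneousPart f m z := by
  have h := (iteratedFDeriv ℂ m f 0).map_smul_univ (fun _ => c) (fun _ => z)
  simp only [Finset.prod_const, Finset.card_univ, Fintype.card_fin] at h
  rw [homogeneousPart, homogeneousPart, h, smul_comm]

theorem IsNormalizedAtZero.homogeneousPart_zero {f : X → X} (hf : IsNormalizedAtZero f) (z : X) :
    homogeneousPart f 0 z = 0 := by
  simp [homogeneousPart, hf.1]

theorem IsNormalizedAtZero.homogeneousPart_one {f : X → X} (hf : IsNormalizedAtZero f) (z : X) :
    homogeneousPart f 1 z = z := by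
  simp [homogeneousPart, hf.2]

/-- The field `(Df)⁻¹ f` is holomorphic along lines through the origin. -/
theorem IsLocallyBiholomorphicOnBall.differentiableOn_line [FiniteDimensional ℂ X] {f : X → X}
    (hf : IsLocallyBiholomorphicOnBall f) {z : X} (hz : ‖z‖ ≤ 1) :
    DifferentiableOn ℂ (fun ζ : ℂ => (fderiv ℂ f (ζ • z)).inverse) (ball 0 1) ∧
      DifferentiableOn ℂ (fun ζ : ℂ => f (ζ • z)) (ball 0 1) := by
  have : CompleteSpace X := FiniteDimensional.complete ℂ X
  have : ProperSpace X := FiniteDimensional.proper ℂ X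
  have hmaps : ∀ ζ ∈ ball (0 : ℂ) 1, ζ • z ∈ ball (0 : X) 1 := by
    intro ζ hζ
    rw [mem_ball_zero_iff] at hζ ⊢
    rw [norm_smul]
    exact (mul_le_of_le_one_right (norm_nonneg _) hz).trans_lt hζ
  refine ⟨fun ζ hζ => DifferentiableAt.differentiableWithinAt ?_,
    hf.1.comp (by fun_prop) hmaps⟩
  obtain ⟨e, he⟩ := hf.2 _ (hmaps ζ hζ)
  have h1 : DifferentiableAt ℂ (ContinuousLinearMap.inverse : (X →L[ℂ] X) → (X →L[ℂ] X))
      (fderiv ℂ f (ζ • z)) := by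
    rw [← he]
    exact (contDiffAt_map_inverse (n := 1) e).differentiableAt (by norm_num)
  have h2 : DifferentiableAt ℂ (fderiv ℂ f) (ζ • z) :=
    (differentiableOn_fderiv isOpen_ball hf.1).differentiableAt
      (isOpen_ball.mem_nhds (hmaps ζ hζ))
  exact DifferentiableAt.comp (f := fun ζ : ℂ => fderiv ℂ f (ζ • z)) ζ h1
    (DifferentiableAt.comp (f := fun ζ : ℂ => ζ • z) ζ h2 (by fun_prop))

/-- Along the line through `z`, the field `(Df)⁻¹ f` of a normalized map is `ζ ↦ ζ Γ(ζ)`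
with `Γ(0) = z`. -/
theorem IsNormalizedAtZero.exists_field_eq_smul [FiniteDimensional ℂ X] {f : X → X}
    (hf : IsNormalizedAtZero f) (hb : IsLocallyBiholomorphicOnBall f) {z : X} (hz : ‖z‖ ≤ 1) :
    ∃ Γ : ℂ → X, DifferentiableOn ℂ Γ (ball 0 1) ∧ Γ 0 = z ∧
      ∀ ζ : ℂ, (fderiv ℂ f (ζ • z)).inverse (f (ζ • z)) = ζ • Γ ζ := by
  have : CompleteSpace X := FiniteDimensional.complete ℂ X
  obtain ⟨hc, hu⟩ := hb.differentiableOn_line hz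
  let G : ℂ → X := fun ζ => (fderiv ℂ f (ζ • z)).inverse (f (ζ • z))
  have hG : DifferentiableOn ℂ G (ball 0 1) := hc.clm_apply hu
  have hball : ball (0 : ℂ) 1 ∈ 𝓝 0 := ball_mem_nhds 0 one_pos
  have hG0 : G 0 = 0 := by simp [G, hf.1]
  refine ⟨dslope G 0, (Complex.differentiableOn_dslope hball).2 hG, ?_, fun ζ => ?_⟩
  · have hline : HasDerivAt (fun ζ : ℂ => ζ • z) z 0 := by
      simpa using (hasDerivAt_id (0 : ℂ)).smul_const z
    have hf0 : HasFDerivAt f (fderiv ℂ f 0) ((0 : ℂ) • z) := by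
      rw [zero_smul]
      exact (hb.1.differentiableAt (ball_mem_nhds 0 one_pos)).hasFDerivAt
    have h1 := hf0.comp_hasDerivAt (0 : ℂ) hline
    have h2 := ((hc.differentiableAt hball).hasDerivAt.clm_apply h1).deriv
    rw [dslope_same]
    refine h2.trans ?_
    simp [hf.1, hf.2]
  · simpa [hG0] using (sub_smul_dslope G 0 ζ).symm

end Normed

/-! ### The upper bound on the polydisk. -/

section Polydisk

variable {n : ℕ}

/-- Homogeneity carries the identity from the ball to the whole space. -/
theorem HasDiagonalPart.apply {f : (Fin n → ℂ) → (Fin n → ℂ)} {m : ℕ} {c : Fin n → ℂ}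
    (hf : HasDiagonalPart f m c) (z : Fin n → ℂ) (k : Fin n) :
    homogeneousPart f m z k = c k * z k ^ m := by
  have hpos : (0 : ℝ) < ‖z‖ + 1 := by positivity
  let t : ℂ := ((‖z‖ + 1 : ℝ) : ℂ)
  have ht : t ≠ 0 := Complex.ofReal_ne_zero.2 hpos.ne'
  have hmem : t⁻¹ • z ∈ ball (0 : Fin n → ℂ) 1 := by
    rw [mem_ball_zero_iff, norm_smul, norm_inv, Complex.norm_real, Real.norm_of_nonneg hpos.le,
      inv_mul_lt_one₀ hpos]
    linarith
  have h := hf _ hmem k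
  rw [homogeneousPart_smul] at h
  simp only [Pi.smul_apply, smul_eq_mul, mul_pow] at h
  have h1 : t⁻¹ ^ m ≠ 0 := pow_ne_zero _ (inv_ne_zero ht)
  exact mul_left_cancel₀ h1 (h.trans (by ring))

/-- Expansion of the equation `Df(x) g(x) = f(x)` up to fourth order along a line. -/
theorem isBigO_field_line {f : (Fin n → ℂ) → (Fin n → ℂ)} {a b : Fin n → ℂ}
    (hf : IsNormalizedAtZero f) (hb : IsLocallyBiholomorphicOnBall f)
    (h2 : HasDiagonalPart f 2 a) (h3 : HasDiagonalPart f 3 b) {z : Fin n → ℂ} (hz : ‖z‖ = 1)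
    {Γ : ℂ → Fin n → ℂ} (hΓ : DifferentiableAt ℂ Γ 0) (hΓ0 : Γ 0 = z)
    (hΓe : ∀ ζ : ℂ, (fderiv ℂ f (ζ • z)).inverse (f (ζ • z)) = ζ • Γ ζ) (k : Fin n) :
    (fun ζ : ℂ => ζ * Γ ζ k * (1 + 2 * a k * (ζ * z k) + 3 * b k * (ζ * z k) ^ 2)
      - (ζ * z k + a k * (ζ * z k) ^ 2 + b k * (ζ * z k) ^ 3
        - 3 * homogeneousPart f 4 z k * ζ ^ 4)) =O[𝓝[≠] 0] fun ζ => ζ ^ 5 := by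
  have hz0 : z ≠ 0 := by rintro rfl; simp at hz
  set P := homogeneousPart f 4 z k with hP
  -- The subtracted polynomial involves x_k only, so its derivative applied to g needs g_k alone;
  -- every mixed contribution sits in h = O(‖x‖⁴).
  let h : (Fin n → ℂ) → ℂ := fun x => f x k - (x k + a k * x k ^ 2 + b k * x k ^ 3)
  have hfk : ∀ x ∈ ball (0 : Fin n → ℂ) 1, HasFDerivAt (fun x => f x k)
      ((ContinuousLinearMap.proj k).comp (fderiv ℂ f x)) x := fun x hx =>
    (hasFDerivAt_pi'.1 (hb.1.differentiableAt (isOpen_ball.mem_nhds hx)).hasFDerivAt) k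
  have hh : ∀ x ∈ ball (0 : Fin n → ℂ) 1, HasFDerivAt h
      ((ContinuousLinearMap.proj k).comp (fderiv ℂ f x)
        - (1 + 2 * a k * x k + 3 * b k * x k ^ 2) •
          (ContinuousLinearMap.proj k : (Fin n → ℂ) →L[ℂ] ℂ)) x := by
    intro x hx
    have hproj : HasFDerivAt (fun x : Fin n → ℂ => x k)
        (ContinuousLinearMap.proj k : (Fin n → ℂ) →L[ℂ] ℂ) x :=
      (ContinuousLinearMap.proj (R := ℂ) (φ := fun _ : Fin n => ℂ) k).hasFDerivAt
    refine ((hfk x hx).sub ((hproj.add ((hproj.pow 2).const_mul (a k))).add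
      ((hproj.pow 3).const_mul (b k)))).congr_fderiv ?_
    ext v
    simp
    ring
  have hhd : DifferentiableOn ℂ h (ball 0 1) := fun x hx =>
    (hh x hx).differentiableAt.differentiableWithinAt
  have hline : ∀ (x : Fin n → ℂ) (N : ℕ), (fun ζ : ℂ => f (ζ • x) k
      - ∑ m ∈ Finset.range N, ζ ^ m * homogeneousPart f m x k) =O[𝓝 0] fun ζ => ζ ^ N := by
    intro x N
    have := isBigO_pi.1 (isBigO_line_sub_sum_homogeneousPart hb.1 x N) k
    simpa using this
  have h4 : h =O[𝓝 0] fun x => ‖x‖ ^ (3 + 1) := by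
    refine isBigO_norm_pow_of_forall_line hhd fun x _ => ?_
    refine (hline x 4).congr_left fun ζ => ?_
    simp only [Finset.sum_range_succ, Finset.sum_range_zero, hf.homogeneousPart_zero,
      hf.homogeneousPart_one, h2.apply, h3.apply, h, Pi.smul_apply, smul_eq_mul, Pi.zero_apply]
    ring
  have hfd := isBigO_fderiv_of_isBigO_norm_pow hhd h4
  have htend : Tendsto (fun ζ : ℂ => ζ • z) (𝓝[≠] 0) (𝓝[≠] 0) := by
    refine tendsto_nhdsWithin_of_tendsto_nhds_of_eventually_within _ ?_ ?_
    · have : Continuous fun ζ : ℂ => ζ • z := by fun_prop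
      simpa using (this.tendsto 0).mono_left nhdsWithin_le_nhds
    · filter_upwards [self_mem_nhdsWithin] with ζ hζ
      exact smul_ne_zero hζ hz0
  have hmem : ∀ ζ ∈ ball (0 : ℂ) 1, ζ • z ∈ ball (0 : Fin n → ℂ) 1 := fun ζ hζ => by
    simpa [norm_smul, hz] using hζ
  have hball : ball (0 : ℂ) 1 ∈ 𝓝[≠] (0 : ℂ) := nhdsWithin_le_nhds (ball_mem_nhds 0 one_pos)
  have hO1 : (fun ζ : ℂ => f (ζ • z) k - (ζ * z k + a k * (ζ * z k) ^ 2 + b k * (ζ * z k) ^ 3)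
      - P * ζ ^ 4) =O[𝓝 0] fun ζ => ζ ^ 5 := by
    refine (hline z 5).congr_left fun ζ => ?_
    simp only [Finset.sum_range_succ, Finset.sum_range_zero, hf.homogeneousPart_zero,
      hf.homogeneousPart_one, h2.apply, h3.apply, Pi.zero_apply, ← hP]
    ring
  have hlineD : ∀ ζ ∈ ball (0 : ℂ) 1, HasDerivAt (fun ζ : ℂ => h (ζ • z) - P * ζ ^ 4)
      (fderiv ℂ h (ζ • z) z - 4 * P * ζ ^ 3) ζ := by
    intro ζ hζ
    have hl : HasDerivAt (fun ζ : ℂ => ζ • z) z ζ := by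
      simpa using (hasDerivAt_id ζ).smul_const z
    have hd := (hhd.differentiableAt (isOpen_ball.mem_nhds (hmem ζ hζ))).hasFDerivAt
    refine ((hd.comp_hasDerivAt ζ hl).sub ((hasDerivAt_pow 4 ζ).const_mul P)).congr_deriv ?_
    push_cast
    ring
  -- Euler's relation: the leading term of Dh(x)x is four times the quartic part.
  have hO2 : (fun ζ : ℂ => fderiv ℂ h (ζ • z) (ζ • z) - 4 * P * ζ ^ 4) =O[𝓝[≠] 0]
      fun ζ => ζ ^ 5 := by
    have h5 : (fun ζ : ℂ => h (ζ • z) - P * ζ ^ 4) =O[𝓝 0] fun ζ : ℂ => ‖ζ‖ ^ (4 + 1) := by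
      have := hO1.norm_right
      simpa [h] using this
    have h6 := isBigO_fderiv_of_isBigO_norm_pow (fun ζ hζ =>
      (hlineD ζ hζ).differentiableAt.differentiableWithinAt) h5
    have h7 : (fun ζ : ℂ => fderiv ℂ h (ζ • z) z - 4 * P * ζ ^ 3) =O[𝓝[≠] 0]
        fun ζ => ζ ^ 4 := by
      refine IsBigO.trans (IsBigO.of_bound 1 ?_) (h6.trans (IsBigO.of_bound 1 (by simp)))
      filter_upwards [hball] with ζ hζ
      rw [← (hlineD ζ hζ).deriv, norm_deriv_eq_norm_fderiv, one_mul]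
    refine ((isBigO_refl (fun ζ : ℂ => ζ) (𝓝[≠] 0)).mul h7).congr (fun ζ => ?_) fun ζ => by ring
    rw [map_smul, smul_eq_mul]
    ring
  -- Replacing g(ζz) by ζz costs only O(ζ⁵), as Dh(ζz) = O(ζ³) and ζΓ(ζ) - ζz = O(ζ²).
  have hO3 : (fun ζ : ℂ => fderiv ℂ h (ζ • z) (ζ • Γ ζ - ζ • z)) =O[𝓝[≠] 0]
      fun ζ => ζ ^ 5 := by
    have h5 : (fun ζ : ℂ => fderiv ℂ h (ζ • z)) =O[𝓝[≠] 0] fun ζ : ℂ => ζ ^ 3 := by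
      have := hfd.comp_tendsto htend
      refine this.trans (IsBigO.of_bound 1 (Eventually.of_forall fun ζ => ?_))
      simp [norm_smul, hz]
    have h6 : (fun ζ : ℂ => ζ • (Γ ζ - z)) =O[𝓝[≠] 0] fun ζ : ℂ => ζ * ζ := by
      have h7 := hΓ.isBigO_sub.mono (nhdsWithin_le_nhds (s := {0}ᶜ))
      rw [hΓ0] at h7
      simpa using (isBigO_refl (fun ζ : ℂ => ζ) (𝓝[≠] 0)).smul h7
    have h8 := h5.norm_norm.mul h6.norm_norm
    refine IsBigO.trans (IsBigO.of_bound 1 (Eventually.of_forall fun ζ => ?_))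
      (h8.trans (IsBigO.of_bound 1 (Eventually.of_forall fun ζ => ?_)))
    · rw [← smul_sub, one_mul, norm_mul, norm_norm, norm_norm]
      exact ContinuousLinearMap.le_opNorm _ _
    · simp only [norm_mul, norm_norm, norm_pow, one_mul]
      exact le_of_eq (by ring)
  refine (((hO1.mono nhdsWithin_le_nhds).sub hO2).sub hO3).congr' ?_ EventuallyEq.rfl
  filter_upwards [hball] with ζ hζ
  have hx := hmem ζ hζ
  have e1 : fderiv ℂ h (ζ • z) (ζ • Γ ζ - ζ • z) + fderiv ℂ h (ζ • z) (ζ • z)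
      = f (ζ • z) k - (1 + 2 * a k * (ζ * z k) + 3 * b k * (ζ * z k) ^ 2) * (ζ * Γ ζ k) := by
    rw [← map_add, sub_add_cancel, (hh _ hx).fderiv, ← hΓe]
    simp only [FunLike.coe_sub, Pi.sub_apply, ContinuousLinearMap.comp_apply,
      (hb.2 _ hx).self_apply_inverse]
    rw [hΓe]
    simp
    ring
  linear_combination -e1

/-- The coefficient bound at points where the `k`-th coordinate has maximal modulus. -/
theorem norm_homogeneousPart_apply_le_of_norm_eq_one {f : (Fin n → ℂ) → (Fin n → ℂ)}
    {a b : Fin n → ℂ} {α : ℝ} (hα : α ≤ 39 / 95)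
    (hf : IsNormalizedAtZero f) (hs : IsAlmostStarlike α f)
    (h2 : HasDiagonalPart f 2 a) (h3 : HasDiagonalPart f 3 b) {z : Fin n → ℂ} (hz : ‖z‖ = 1)
    {k : Fin n} (hk : ‖z k‖ = 1) :
    ‖homogeneousPart f 4 z k‖ ≤ (1 - α) * (3 - 4 * α) * (4 - 6 * α) / 3 := by
  obtain ⟨Γ, hΓ, hΓ0, hΓe⟩ := hf.exists_field_eq_smul hs.1 hz.le
  have hk0 : z k ≠ 0 := by rw [← norm_pos_iff, hk]; exact one_pos
  have hz0 : z ≠ 0 := by rintro rfl; simp at hk0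
  have hO := isBigO_field_line hf hs.1 h2 h3 hz
    (hΓ.differentiableAt (ball_mem_nhds 0 one_pos)) hΓ0 hΓe k
  let p : ℂ → ℂ := fun ζ => Γ ζ k / z k
  have hp : DifferentiableOn ℂ p (ball 0 1) := (differentiableOn_pi.1 hΓ k).div_const _
  have hp0 : p 0 = 1 := by simp [p, hΓ0, hk0]
  have hre : ∀ ζ ∈ ball (0 : ℂ) 1, α ≤ (p ζ).re := by
    intro ζ hζ
    rcases eq_or_ne ζ 0 with rfl | hζ0
    · rw [hp0, Complex.one_re]; linarith
    have hζn : 0 < ‖ζ‖ := norm_pos_iff.2 hζ0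
    have hxn : ‖ζ • z‖ = ‖ζ‖ := by rw [norm_smul, hz, mul_one]
    -- The phase that makes `c • proj k` a support functional at ζz; this uses |z_k| = ‖z‖.
    let c : ℂ := conj (ζ * z k) / ‖ζ‖
    have hc : ‖c‖ = 1 := by
      simp only [c, norm_div, RCLike.norm_conj, norm_mul, hk, Complex.norm_real, norm_norm]
      field_simp
    let T : (Fin n → ℂ) →L[ℂ] ℂ := c • ContinuousLinearMap.proj k
    have hcz : c * (ζ * z k) = ‖ζ‖ := by
      simp only [c]
      rw [div_mul_eq_mul_div, Complex.conj_mul', norm_mul, hk, mul_one, sq, mul_div_assoc,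
        div_self (by exact_mod_cast hζn.ne'), mul_one]
    have hT : T ∈ supportFunctionals (ζ • z) := by
      have hTx : T (ζ • z) = (‖ζ • z‖ : ℂ) := by
        rw [hxn, ← hcz]
        simp [T]
        ring
      refine ⟨le_antisymm (T.opNorm_le_bound zero_le_one fun x => ?_) ?_, hTx⟩
      · simp only [T, FunLike.coe_smul, Pi.smul_apply, ContinuousLinearMap.proj_apply,
          norm_smul, hc, one_mul]
        exact norm_le_pi_norm x k
      · have := T.le_opNorm (ζ • z)
        rw [hTx, Complex.norm_real, norm_norm] at this
        exact le_of_mul_le_mul_right (by simpa using this) (hxn ▸ hζn)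
    have h := hs.2 (ζ • z) (by simpa [hxn] using hζ) (smul_ne_zero hζ0 hz0) T hT
    have hTv : T (ζ • Γ ζ) = ((‖ζ‖ : ℝ) : ℂ) * p ζ := by
      rw [← hcz]
      simp only [T, p, FunLike.coe_smul, Pi.smul_apply, ContinuousLinearMap.proj_apply,
        smul_eq_mul]
      field_simp
    rw [hΓe, hTv, Complex.re_ofReal_mul, hxn, mul_comm] at h
    exact le_of_mul_le_mul_left h hζn
  have hO' : (fun ζ : ℂ => p ζ * (1 + 2 * (a k * z k) * ζ + 3 * (b k * z k ^ 2) * ζ ^ 2)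
      - (1 + (a k * z k) * ζ + (b k * z k ^ 2) * ζ ^ 2
        - 3 * (homogeneousPart f 4 z k / z k) * ζ ^ 3)) =O[𝓝[≠] 0] fun ζ => ζ ^ 4 := by
    have h1 := ((isBigO_refl (fun ζ : ℂ => ζ⁻¹) (𝓝[≠] 0)).const_mul_left (z k)⁻¹).mul hO
    refine h1.congr' ?_ ?_
    · filter_upwards [self_mem_nhdsWithin] with ζ hζ
      rw [Set.mem_compl_singleton_iff] at hζ
      simp only [p]
      field_simp
    · filter_upwards [self_mem_nhdsWithin] with ζ hζ
      rw [Set.mem_compl_singleton_iff] at hζ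
      field_simp
  have h := norm_coeff_le_of_le_re hα hp hp0 hre hO'
  rwa [norm_div, hk, div_one] at h

/-- The support functional controls component k only where |z_k| = ‖z‖. With the other coordinates
fixed, that component is an entire function of the k-th coordinate ω, and the circle |ω| = ‖z‖
consists of such points, so the maximum principle covers the disc. -/
theorem norm_homogeneousPart_le {f : (Fin n → ℂ) → (Fin n → ℂ)}
    {a b : Fin n → ℂ} {α : ℝ} (hα : α ≤ 39 / 95)
    (hf : IsNormalizedAtZero f) (hs : IsAlmostStarlike α f)
    (h2 : HasDiagonalPart f 2 a) (h3 : HasDiagonalPart f 3 b) (z : Fin n → ℂ) :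
    ‖homogeneousPart f 4 z‖ ≤ (1 - α) * (3 - 4 * α) * (4 - 6 * α) / 3 * ‖z‖ ^ 4 := by
  have hC : 0 ≤ (1 - α) * (3 - 4 * α) * (4 - 6 * α) / 3 := by
    have h1 : 0 ≤ 1 - α := by linarith
    have h2 : 0 ≤ 3 - 4 * α := by linarith
    have h3 : 0 ≤ 4 - 6 * α := by linarith
    positivity
  have hmax : ∀ (y : Fin n → ℂ) (k : Fin n), y ≠ 0 → ‖y k‖ = ‖y‖ →
      ‖homogeneousPart f 4 y k‖ ≤ (1 - α) * (3 - 4 * α) * (4 - 6 * α) / 3 * ‖y‖ ^ 4 := by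
    intro y k hy hyk
    have hyn : 0 < ‖y‖ := norm_pos_iff.2 hy
    have hyc : ((‖y‖ : ℝ) : ℂ) ≠ 0 := by exact_mod_cast hyn.ne'
    have h := norm_homogeneousPart_apply_le_of_norm_eq_one hα hf hs h2 h3
      (z := ((‖y‖ : ℝ) : ℂ)⁻¹ • y) (k := k)
      (by rw [norm_smul, norm_inv, Complex.norm_real, norm_norm, inv_mul_cancel₀ hyn.ne'])
      (by rw [Pi.smul_apply, norm_smul, norm_inv, Complex.norm_real, norm_norm, hyk,
        inv_mul_cancel₀ hyn.ne'])
    rw [homogeneousPart_smul, Pi.smul_apply, norm_smul, norm_pow, norm_inv, Complex.norm_real,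
      norm_norm, inv_pow, inv_mul_le_iff₀ (by positivity)] at h
    linarith
  rcases eq_or_ne z 0 with rfl | hz
  · have : homogeneousPart f 4 (0 : Fin n → ℂ) = 0 := by
      have := homogeneousPart_smul f 4 0 (0 : Fin n → ℂ)
      simpa using this
    simp [this]
  have hzn : 0 < ‖z‖ := norm_pos_iff.2 hz
  refine (pi_norm_le_iff_of_nonneg (by positivity)).2 fun k => ?_
  let Q : ℂ → ℂ := fun ω => homogeneousPart f 4 (Function.update z k ω) k
  have hQ : Differentiable ℂ Q := by
    have h1 : Differentiable ℂ fun ω : ℂ => Function.update z k ω := fun ω =>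
      (hasFDerivAt_update z ω).differentiableAt
    have h2 : Differentiable ℂ fun y : Fin n → ℂ => iteratedFDeriv ℂ 4 f 0 fun _ => y :=
      fun y => by
        have h3 : DifferentiableAt ℂ (iteratedFDeriv ℂ 4 f 0) (fun _ => y) :=
          (iteratedFDeriv ℂ 4 f 0).hasStrictFDerivAt _ |>.hasFDerivAt.differentiableAt
        exact DifferentiableAt.comp (f := fun (y : Fin n → ℂ) (_ : Fin 4) => y) y h3
          (by fun_prop)
    exact (differentiable_pi.1 ((h2.comp h1).const_smul ((Nat.factorial 4 : ℂ)⁻¹)) k)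
  have hzk : ‖z k‖ ≤ ‖z‖ := norm_le_pi_norm z k
  have h := Complex.norm_le_of_forall_mem_frontier_norm_le (f := Q) (isBounded_ball (x := (0 : ℂ))
    (r := ‖z‖)) hQ.diffContOnCl (C := (1 - α) * (3 - 4 * α) * (4 - 6 * α) / 3 * ‖z‖ ^ 4)
    (fun ω hω => ?_) (z := z k) (by rw [closure_ball _ hzn.ne']; simpa using hzk)
  · simpa [Q] using h
  · rw [frontier_ball _ hzn.ne', mem_sphere_zero_iff_norm] at hω
    have hy : ‖Function.update z k ω‖ = ‖z‖ := by
      refine le_antisymm ((pi_norm_le_iff_of_nonneg hzn.le).2 fun j => ?_) ?_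
      · rcases eq_or_ne j k with rfl | hj
        · simp [hω]
        · rw [Function.update_of_ne hj]
          exact norm_le_pi_norm z j
      · rw [← hω]
        simpa using norm_le_pi_norm (Function.update z k ω) k
    have h1 := hmax (Function.update z k ω) k (norm_pos_iff.1 (hy ▸ hzn)) (by simp [hy, hω])
    rwa [hy] at h1

end Polydisk

/-! ### Support functionals of the maximum norm. -/

section SupportFunctionals

variable {n : ℕ}

theorem ContinuousLinearMap.apply_eq_sum_single (T : (Fin n → ℂ) →L[ℂ] ℂ) (v : Fin n → ℂ) :
    T v = ∑ j, v j * T (Pi.single j 1) := by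
  conv_lhs => rw [pi_eq_sum_univ' v]
  simp only [map_sum, map_smul, smul_eq_mul]

/-- The dual of the maximum norm is the sum norm. -/
theorem ContinuousLinearMap.sum_norm_apply_single_le (T : (Fin n → ℂ) →L[ℂ] ℂ) :
    ∑ j, ‖T (Pi.single j 1)‖ ≤ ‖T‖ := by
  let y : Fin n → ℂ := fun j => conj (T (Pi.single j 1)) / ‖T (Pi.single j 1)‖
  have hy : ‖y‖ ≤ 1 := (pi_norm_le_iff_of_nonneg zero_le_one).2 fun j => by
    simp only [y, norm_div, RCLike.norm_conj, Complex.norm_real, norm_norm]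
    exact div_self_le_one _
  have hT : T y = ((∑ j, ‖T (Pi.single j 1)‖ : ℝ) : ℂ) := by
    rw [T.apply_eq_sum_single y, Complex.ofReal_sum]
    refine Finset.sum_congr rfl fun j _ => ?_
    simp only [y]
    rcases eq_or_ne (T (Pi.single j 1)) 0 with h0 | h0
    · simp [h0]
    · rw [div_mul_eq_mul_div, Complex.conj_mul', sq, mul_div_assoc,
        div_self (by simpa using h0), mul_one]
  have h := T.le_opNorm_of_le hy
  rw [hT, Complex.norm_real, Real.norm_of_nonneg (Finset.sum_nonneg fun _ _ => norm_nonneg _),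
    mul_one] at h
  exact h

/-- A support functional of `x` takes nonnegative real values on the coordinates of `x`. -/
theorem supportFunctionals_mul_eq_norm {x : Fin n → ℂ} {T : (Fin n → ℂ) →L[ℂ] ℂ}
    (hT : T ∈ supportFunctionals x) (j : Fin n) :
    x j * T (Pi.single j 1) = ((‖x j * T (Pi.single j 1)‖ : ℝ) : ℂ) := by
  set τ : Fin n → ℂ := fun j => T (Pi.single j 1) with hτ
  have hle : ∀ i, (x i * τ i).re ≤ ‖x‖ * ‖τ i‖ := fun i =>
    (Complex.re_le_norm _).trans (by
      rw [norm_mul]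
      exact mul_le_mul_of_nonneg_right (norm_le_pi_norm x i) (norm_nonneg _))
  have hsum : ∑ i, (x i * τ i).re = ‖x‖ := by
    have h := congrArg Complex.re hT.2
    rw [T.apply_eq_sum_single x, Complex.re_sum, Complex.ofReal_re] at h
    exact h
  have hge : ∑ i, ‖x‖ * ‖τ i‖ ≤ ∑ i, (x i * τ i).re := by
    rw [hsum, ← Finset.mul_sum]
    refine mul_le_of_le_one_right (norm_nonneg _) ?_
    rw [← hT.1]
    exact T.sum_norm_apply_single_le
  -- Termwise ≤ together with ≥ for the totals forces equality in every term.
  have heq := (Finset.sum_eq_sum_iff_of_le fun i _ => hle i).1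
    (le_antisymm (Finset.sum_le_sum fun i _ => hle i) hge) j (Finset.mem_univ j)
  have h1 : (x j * τ j).re = ‖x j * τ j‖ := by
    refine le_antisymm (Complex.re_le_norm _) ?_
    rw [heq, norm_mul]
    exact mul_le_mul_of_nonneg_right (norm_le_pi_norm x j) (norm_nonneg _)
  have h2 := Complex.re_eq_norm.1 h1
  exact (Complex.eq_coe_norm_of_nonneg h2)

end SupportFunctionals

/-! ### The extremal mapping. -/

/-- The extremal almost starlike function of order `α` in the disc, where `γ = 1 - 2 α`. -/
noncomputable def extremalFunction (γ : ℝ) (ζ : ℂ) : ℂ :=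
  ζ * (1 + γ * ζ) ^ (-((1 + γ) / γ : ℂ))

theorem norm_ofReal_mul_lt_one {γ : ℝ} (h0 : 0 < γ) (h1 : γ ≤ 1) {ζ : ℂ}
    (hζ : ζ ∈ ball (0 : ℂ) 1) : ‖(γ : ℂ) * ζ‖ < 1 := by
  rw [mem_ball_zero_iff] at hζ
  rw [norm_mul, Complex.norm_real, Real.norm_of_nonneg h0.le]
  nlinarith [norm_nonneg ζ]

theorem hasDerivAt_extremalFunction {γ : ℝ} (h0 : 0 < γ) (h1 : γ ≤ 1) {ζ : ℂ}
    (hζ : ζ ∈ ball (0 : ℂ) 1) :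
    HasDerivAt (extremalFunction γ)
      ((1 + γ * ζ) ^ (-((1 + γ) / γ : ℂ)) * ((1 - ζ) / (1 + γ * ζ))) ζ := by
  have hs : 1 + γ * ζ ∈ Complex.slitPlane :=
    Complex.mem_slitPlane_of_norm_lt_one (norm_ofReal_mul_lt_one h0 h1 hζ)
  have hne : 1 + γ * ζ ≠ 0 := Complex.slitPlane_ne_zero hs
  have hγ : (γ : ℂ) ≠ 0 := by exact_mod_cast h0.ne'
  have hlin : HasDerivAt (fun ζ : ℂ => 1 + (γ : ℂ) * ζ) γ ζ := by
    simpa using ((hasDerivAt_id ζ).const_mul (γ : ℂ)).const_add 1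
  refine ((hasDerivAt_id ζ).mul (hlin.cpow_const (c := -((1 + γ) / γ : ℂ)) hs)).congr_deriv ?_
  rw [Complex.cpow_sub _ _ hne, Complex.cpow_one]
  simp only [id]
  field_simp
  ring

/-- The real part exceeds α by (1 - α)(1 - |ζ|²)/|1 - ζ|². -/
theorem le_re_one_add_mul_div_one_sub {α : ℝ} (hα : α ≤ 1) {ζ : ℂ} (hζ : ζ ∈ ball (0 : ℂ) 1) :
    α ≤ ((1 + ((1 - 2 * α : ℝ) : ℂ) * ζ) / (1 - ζ)).re := by
  have hq : Complex.normSq ζ < 1 := by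
    rw [mem_ball_zero_iff] at hζ
    rw [Complex.normSq_eq_norm_sq]
    exact pow_lt_one₀ (norm_nonneg _) hζ two_ne_zero
  have hne : 1 - ζ ≠ 0 := by
    intro h
    rw [← sub_eq_zero.1 h] at hq
    simp at hq
  have hpos : 0 < Complex.normSq (1 - ζ) := Complex.normSq_pos.2 hne
  rw [Complex.div_re, ← add_div, le_div_iff₀ hpos]
  rw [Complex.normSq_apply] at hq ⊢
  simp only [Complex.sub_re, Complex.sub_im, Complex.add_re, Complex.add_im, Complex.one_re,
    Complex.one_im, Complex.mul_re, Complex.mul_im, Complex.ofReal_re, Complex.ofReal_im]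
  nlinarith [mul_nonneg (sub_nonneg.2 hα) (sub_pos.2 hq).le]

/-- The Taylor coefficients of the extremal function. -/
noncomputable def extremalCoeff (γ : ℝ) (m : ℕ) : ℂ :=
  if m = 0 then 0 else Ring.choose (-((1 + γ) / γ : ℂ)) (m - 1) * γ ^ (m - 1)

theorem isBigO_extremalFunction_sub (γ : ℝ) (N : ℕ) :
    (fun ζ : ℂ => extremalFunction γ ζ - ∑ m ∈ Finset.range (N + 1), extremalCoeff γ m * ζ ^ m)
      =O[𝓝 0] fun ζ => ζ ^ (N + 1) := by
  have h := (Complex.one_add_cpow_hasFPowerSeriesAt_zero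
    (a := -((1 + γ) / γ : ℂ))).isBigO_sub_partialSum_pow N
  have ht : Tendsto (fun ζ : ℂ => (γ : ℂ) * ζ) (𝓝 0) (𝓝 0) := by
    have : Continuous fun ζ : ℂ => (γ : ℂ) * ζ := by fun_prop
    simpa using this.tendsto 0
  have h1 : (fun ζ : ℂ => (1 + γ * ζ) ^ (-((1 + γ) / γ : ℂ))
      - ∑ m ∈ Finset.range N, Ring.choose (-((1 + γ) / γ : ℂ)) m * (γ * ζ) ^ m)
      =O[𝓝 0] fun ζ : ℂ => ζ ^ N := by
    have h2 := h.comp_tendsto ht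
    refine (h2.congr_left fun ζ => ?_).trans (IsBigO.of_bound (|γ| ^ N)
      (Eventually.of_forall fun ζ => ?_))
    · simp [FormalMultilinearSeries.partialSum, binomialSeries, mul_comm]
    · simp [mul_pow]
  refine ((isBigO_refl (fun ζ : ℂ => ζ) (𝓝 0)).mul h1).congr (fun ζ => ?_) fun ζ => by ring
  rw [Finset.sum_range_succ']
  simp only [extremalFunction, extremalCoeff, mul_sub, Finset.mul_sum, Nat.add_eq_zero_iff,
    one_ne_zero, and_false, if_false, if_true, zero_mul, add_zero, Nat.add_sub_cancel]
  congr 1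
  exact Finset.sum_congr rfl fun m _ => by ring

/-- For γ = 1 - 2α the three factors are 2(1 - α), 3 - 4α and 4 - 6α, so the modulus is the sharp
constant. -/
theorem extremalCoeff_four {γ : ℝ} (h0 : 0 < γ) :
    extremalCoeff γ 4 = ((-((1 + γ) * (1 + 2 * γ) * (1 + 3 * γ) / 6) : ℝ) : ℂ) := by
  have hγ : (γ : ℂ) ≠ 0 := by exact_mod_cast h0.ne'
  have h : ∀ a : ℂ, Ring.choose a 3 = a * (a - 1) * (a - 2) / 6 := by
    intro a
    have h2 : (2 : Polynomial ℤ).smeval a = 2 := by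
      simpa using Polynomial.smeval_natCast ℤ a 2
    have h1 := Ring.descPochhammer_eq_factorial_smul_choose a 3
    simp [descPochhammer_succ_right, Polynomial.smeval_mul, Polynomial.smeval_sub,
      Polynomial.smeval_X, Nat.factorial] at h1
    rw [h2] at h1
    rw [eq_div_iff (by norm_num)]
    linear_combination -h1
  simp only [extremalCoeff, h]
  push_cast
  norm_num
  field_simp
  ring

section ExtremalMap

variable {n : ℕ}

/-- The extremal map of the polydisk. -/
noncomputable def extremalMap (n : ℕ) (γ : ℝ) (z : Fin n → ℂ) : Fin n → ℂ :=
  fun k => extremalFunction γ (z k)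

theorem hasFDerivAt_extremalMap {γ : ℝ} (h0 : 0 < γ) (h1 : γ ≤ 1) {x : Fin n → ℂ}
    (hx : x ∈ ball (0 : Fin n → ℂ) 1) :
    HasFDerivAt (extremalMap n γ) (ContinuousLinearMap.pi fun k =>
      ((1 + γ * x k) ^ (-((1 + γ) / γ : ℂ)) * ((1 - x k) / (1 + γ * x k))) •
        (ContinuousLinearMap.proj k : (Fin n → ℂ) →L[ℂ] ℂ)) x := by
  refine hasFDerivAt_pi.2 fun k => ?_
  have hk : x k ∈ ball (0 : ℂ) 1 := by
    rw [mem_ball_zero_iff] at hx ⊢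
    exact (norm_le_pi_norm x k).trans_lt hx
  exact (hasDerivAt_extremalFunction h0 h1 hk).comp_hasFDerivAt x
    (ContinuousLinearMap.proj (R := ℂ) (φ := fun _ : Fin n => ℂ) k).hasFDerivAt

theorem isNormalizedAtZero_extremalMap {γ : ℝ} (h0 : 0 < γ) (h1 : γ ≤ 1) :
    IsNormalizedAtZero (extremalMap n γ) := by
  refine ⟨by ext k; simp [extremalMap, extremalFunction], ?_⟩
  rw [(hasFDerivAt_extremalMap h0 h1 (by simp)).fderiv]
  ext v k
  simp

/-- Here (Df)⁻¹f has coordinates x_k(1 + γx_k)/(1 - x_k). A support functional T puts nonnegative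
weights x_k T(e_k) of total ‖x‖ on the quotients, so the bound Re ≥ α on each quotient suffices. -/
theorem isAlmostStarlike_extremalMap {α : ℝ} (h0 : 0 ≤ α) (h1 : α < 1 / 2) :
    IsAlmostStarlike α (extremalMap n (1 - 2 * α)) := by
  set γ : ℝ := 1 - 2 * α with hγ
  have hγ0 : 0 < γ := by linarith
  have hγ1 : γ ≤ 1 := by linarith
  have hmem : ∀ {x : Fin n → ℂ}, x ∈ ball (0 : Fin n → ℂ) 1 → ∀ k, x k ∈ ball (0 : ℂ) 1 := by
    intro x hx k
    rw [mem_ball_zero_iff] at hx ⊢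
    exact (norm_le_pi_norm x k).trans_lt hx
  have hne : ∀ {ζ : ℂ}, ζ ∈ ball (0 : ℂ) 1 → 1 + (γ : ℂ) * ζ ≠ 0 := fun hζ =>
    Complex.slitPlane_ne_zero
      (Complex.mem_slitPlane_of_norm_lt_one (norm_ofReal_mul_lt_one hγ0 hγ1 hζ))
  have hne' : ∀ {ζ : ℂ}, ζ ∈ ball (0 : ℂ) 1 → 1 - ζ ≠ 0 := by
    intro ζ hζ h
    rw [mem_ball_zero_iff, ← sub_eq_zero.1 h, norm_one] at hζ
    exact lt_irrefl _ hζ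
  have hpow : ∀ {ζ : ℂ}, ζ ∈ ball (0 : ℂ) 1 → (1 + (γ : ℂ) * ζ) ^ (-((1 + γ) / γ : ℂ)) ≠ 0 :=
    fun hζ h => hne hζ ((Complex.cpow_eq_zero_iff _ _).1 h).1
  have hinv : ∀ x ∈ ball (0 : Fin n → ℂ) 1, (fderiv ℂ (extremalMap n γ) x).IsInvertible := by
    intro x hx
    rw [(hasFDerivAt_extremalMap hγ0 hγ1 hx).fderiv]
    refine ContinuousLinearMap.IsInvertible.of_inverse (g := ContinuousLinearMap.pi fun k =>
      ((1 + γ * x k) ^ (-((1 + γ) / γ : ℂ)) * ((1 - x k) / (1 + γ * x k)))⁻¹ •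
        (ContinuousLinearMap.proj k : (Fin n → ℂ) →L[ℂ] ℂ)) ?_ ?_
    · ext1 v
      funext k
      simp [-mul_inv_rev, mul_inv_cancel_left₀ (mul_ne_zero (hpow (hmem hx k))
        (div_ne_zero (hne' (hmem hx k)) (hne (hmem hx k))))]
    · ext1 v
      funext k
      simp [-mul_inv_rev, inv_mul_cancel_left₀ (mul_ne_zero (hpow (hmem hx k))
        (div_ne_zero (hne' (hmem hx k)) (hne (hmem hx k))))]
  refine ⟨⟨fun x hx => (hasFDerivAt_extremalMap hγ0 hγ1
    hx).differentiableAt.differentiableWithinAt, hinv⟩, fun x hx _ T hT => ?_⟩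
  have hv : (fderiv ℂ (extremalMap n γ) x).inverse (extremalMap n γ x)
      = fun k => x k * ((1 + γ * x k) / (1 - x k)) := by
    rw [(hinv x hx).inverse_apply_eq, (hasFDerivAt_extremalMap hγ0 hγ1 hx).fderiv]
    funext k
    have e1 : 1 + x k * (γ : ℂ) ≠ 0 := mul_comm (γ : ℂ) (x k) ▸ hne (hmem hx k)
    have e2 := hne' (hmem hx k)
    simp only [extremalMap, extremalFunction, ContinuousLinearMap.pi_apply, FunLike.coe_smul,
      Pi.smul_apply, ContinuousLinearMap.proj_apply, smul_eq_mul]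
    field_simp
  have hsum : ∑ j, ‖x j * T (Pi.single j 1)‖ = ‖x‖ := by
    have h := hT.2
    rw [T.apply_eq_sum_single x,
      Finset.sum_congr rfl fun j _ => supportFunctionals_mul_eq_norm hT j] at h
    exact_mod_cast h
  rw [hv, T.apply_eq_sum_single, Complex.re_sum, ← hsum, Finset.mul_sum]
  refine Finset.sum_le_sum fun j _ => ?_
  have e : x j * ((1 + γ * x j) / (1 - x j)) * T (Pi.single j 1)
      = ((‖x j * T (Pi.single j 1)‖ : ℝ) : ℂ) * ((1 + γ * x j) / (1 - x j)) := by
    rw [← supportFunctionals_mul_eq_norm hT j]; ring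
  rw [e, Complex.re_ofReal_mul, mul_comm]
  exact mul_le_mul_of_nonneg_left (le_re_one_add_mul_div_one_sub (by linarith) (hmem hx j))
    (norm_nonneg _)

/-- Both sides are Taylor coefficients of the same function of ζ along the line through z. The map
is diagonal in every degree, in particular in degrees 2 and 3. -/
theorem homogeneousPart_extremalMap {γ : ℝ} (h0 : 0 < γ) (h1 : γ ≤ 1) (z : Fin n → ℂ)
    (k : Fin n) (m : ℕ) :
    homogeneousPart (extremalMap n γ) m z k = extremalCoeff γ m * z k ^ m := by
  have hd : DifferentiableOn ℂ (extremalMap n γ) (ball 0 1) := fun x hx =>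
    (hasFDerivAt_extremalMap h0 h1 hx).differentiableAt.differentiableWithinAt
  have e1 := isBigO_pi.1 (isBigO_line_sub_sum_homogeneousPart hd z (m + 1)) k
  have ht : Tendsto (fun ζ : ℂ => ζ * z k) (𝓝 0) (𝓝 0) := by
    have : Continuous fun ζ : ℂ => ζ * z k := by fun_prop
    simpa using this.tendsto 0
  have e2 : (fun ζ : ℂ => extremalFunction γ (ζ * z k)
      - ∑ j ∈ Finset.range (m + 1), extremalCoeff γ j * (ζ * z k) ^ j)
      =O[𝓝 0] fun ζ : ℂ => ζ ^ (m + 1) := by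
    refine ((isBigO_extremalFunction_sub γ m).comp_tendsto ht).trans
      (IsBigO.of_bound (‖z k‖ ^ (m + 1)) (Eventually.of_forall fun ζ => ?_))
    simp [mul_pow, mul_comm]
  have h := coeff_eq_zero_of_isBigO (N := m + 1)
    (c := fun j => homogeneousPart (extremalMap n γ) j z k - extremalCoeff γ j * z k ^ j)
    (((e2.sub e1).mono nhdsWithin_le_nhds).congr_left fun ζ => ?_) m (Nat.lt_succ_self m)
  · exact sub_eq_zero.1 h
  · simp only [extremalMap, Pi.sub_apply, Finset.sum_apply, Pi.smul_apply, smul_eq_mul,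
      sub_sub_sub_cancel_left, ← Finset.sum_sub_distrib]
    exact Finset.sum_congr rfl fun j _ => by ring

end ExtremalMap

theorem theorem3p5 (n : ℕ) (hn : 1 ≤ n) (α : ℝ) (hα0 : 0 ≤ α)
    (hα1 : α ≤ (37 - Real.sqrt 505) / 36) :
    (∀ (f : (Fin n → ℂ) → (Fin n → ℂ)) (a b : Fin n → ℂ),
      IsNormalizedAtZero f → IsAlmostStarlike α f →
      HasDiagonalPart f 2 a → HasDiagonalPart f 3 b →
      ∀ z ∈ Metric.ball (0 : Fin n → ℂ) 1,
        ‖homogeneousPart f 4 z‖ ≤ (1 - α) * (3 - 4 * α) * (4 - 6 * α) / 3 * ‖z‖ ^ 4) ∧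
    (∃ (f : (Fin n → ℂ) → (Fin n → ℂ)) (a b : Fin n → ℂ),
      IsNormalizedAtZero f ∧ IsAlmostStarlike α f ∧
      HasDiagonalPart f 2 a ∧ HasDiagonalPart f 3 b ∧
      ∃ z ∈ Metric.ball (0 : Fin n → ℂ) 1, z ≠ 0 ∧
        ‖homogeneousPart f 4 z‖ = (1 - α) * (3 - 4 * α) * (4 - 6 * α) / 3 * ‖z‖ ^ 4) := by
  -- With β = 1 - α this is β ≥ 56/95; the lower bound 22.4 for √505 suffices. It also gives α <
  -- 1/2, hence γ > 0.
  have hα : α ≤ 39 / 95 := by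
    have : (112 / 5 : ℝ) ≤ Real.sqrt 505 := Real.le_sqrt_of_sq_le (by norm_num)
    linarith
  refine ⟨fun f a b hf hs h2 h3 z _ => norm_homogeneousPart_le hα hf hs h2 h3 z, ?_⟩
  have h0 : 0 < 1 - 2 * α := by linarith
  have h1 : 1 - 2 * α ≤ 1 := by linarith
  have hne : Nonempty (Fin n) := ⟨⟨0, hn⟩⟩
  have hnorm : ‖(fun _ => 1 / 2 : Fin n → ℂ)‖ = 1 / 2 := by
    rw [pi_norm_const]; norm_num
  refine ⟨extremalMap n (1 - 2 * α), fun _ => extremalCoeff (1 - 2 * α) 2,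
    fun _ => extremalCoeff (1 - 2 * α) 3, isNormalizedAtZero_extremalMap h0 h1,
    isAlmostStarlike_extremalMap hα0 (by linarith),
    fun z _ k => homogeneousPart_extremalMap h0 h1 z k 2,
    fun z _ k => homogeneousPart_extremalMap h0 h1 z k 3, fun _ => 1 / 2, ?_, ?_, ?_⟩
  · rw [mem_ball_zero_iff, hnorm]; norm_num
  · rw [← norm_pos_iff, hnorm]; norm_num
  · have h4 : homogeneousPart (extremalMap n (1 - 2 * α)) 4 (fun _ => 1 / 2)
        = fun _ => extremalCoeff (1 - 2 * α) 4 * (1 / 2) ^ 4 :=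
      funext fun k => homogeneousPart_extremalMap h0 h1 _ k 4
    rw [h4, pi_norm_const, hnorm, extremalCoeff_four h0, norm_mul, Complex.norm_real, norm_neg,
      Real.norm_of_nonneg (by
        have h2 : 0 ≤ 1 + (1 - 2 * α) := by linarith
        positivity), norm_pow]
    norm_num
    ring
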